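/- Let $d\ge 0$, let $G=(V,E)$ be a finite simple graph that is generically minimally rigid in $\mathbb R^d$, and let $K\subseteq V$ be a set of $d$ pairwise adjacent vertices (the fixed vertices). Put $V'=V\setminus K$, let $E'$ be the set of edges of $G$ with at least one endpoint in $V'$, and let $m=(d+1)\,|V'|$. **Sphere equations.** Given fixed points $p_v$ ($v\in K$) and lengths $\lambda_e>0$ ($e\in E'$), consider the following systems $F$ of polynomials in $m$ variables, a block of $d+1$ variables $X_u$ for each $u\in V'$. * *Euclidean case.* $p_v\in\mathbb R^d$, $X_u=(x_{u,1},\dots,x_{u,d},x_{u,d+1})$ with $x_{u,d+1}=s_u$; for $v\in K$ the constants $x_{v,i}=p_{v,i}$ and $s_v=\lVert p_v\rVert^2$ are substituted. The polynomials of $F$ are $\sum_{i=1}^d x_{u,i}^2-s_u$ for $u\in V'$ and $s_u+s_v-2\sum_{i=1}^d x_{u,i}x_{v,i}-\lambda_{uv}^2$ for $uv\in E'$. * *Spherical case.* $p_v\in S^d\subset\mathbb R^{d+1}$, $X_u=(x_{u,1},\dots,x_{u,d+1})$; for $v\in K$ the constants $x_{v,i}=p_{v,i}$ are substituted. The polynomials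 of $F$ are $\sum_{i=1}^{d+1} x_{u,i}^2-1$ for $u\in V'$ and $2-2\sum_{i=1}^{d+1} x_{u,i}x_{v,i}-\lambda_{uv}^2$ for $uv\in E'$. **Face systems.** For $w\in\mathbb R^m$ the initial form $f^w$ of a polynomial $f$ is the sum of the terms of $f$ whose exponent vectors have minimal inner product with $w$ among those of $f$, and $F^w=(f^w)_{f\in F}$. Let $e_{u,j}$ be the standard unit vectors of $\mathbb R^m$ and $\delta_u=-\sum_{j=1}^{d+1}e_{u,j}$ for $u\in V'$. A *face normal* is a nonzero vector $w\in\mathbb R^m$ that is a sum of distinct vectors from $\{e_{u,j}\}\cup\{\delta_u\}$. **Transformed system.** A choice of $\delta$-variables is a choice, for each $u\in V'$, of one coordinate variable $x_{u,L(u)}$ of the block $X_u$ (with $L(u)\in\{1,\dots,d\}$ in the Euclidean case, so that $s_u$ is never chosen, and $L(u)\in\{1,\dots,d+1\}$ in the spherical case). For such a choice, substitute $x_{u,L(u)}=1/t_{u,L(u)}$ and $x_{u,j}=t_{u,j}/t_{u,L(u)}$ ($j\neq L(u)$) in each $f\in F$, and multiply the result by $\prod_{u\in V'} t_{u,L(u)}^{\deg_{X_u}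 f}$, where $\deg_{X_u}f$ is the degree of $f$ in the variables of $X_u$. The resulting polynomials form the system $\widetilde F_L(\mathbf t)$; its $\delta$-variables are the $t_{u,L(u)}$. **Statement.** In each of the two cases, for generic parameters $(p,\lambda)$ the following are equivalent: 1. there is a face normal $w\in\mathbb R^m$ such that $F^w$ has a root in $(\mathbb C^*)^m$; 2. there is a choice $L$ of $\delta$-variables such that $\widetilde F_L(\mathbf t)$ has a solution in $\mathbb C^m$ with $t_{u,L(u)}=0$ for at least one $u\in V'$. Here "for generic parameters" means: there is a real polynomial $\Phi$ in the parameters, not vanishing at all admissible $(p,\lambda)$ of the case in question, such that the equivalence holds at every admissible $(p,\lambda)$ with $\Phi(p,\lambda)\neq0$. -/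

import Mathlib

open MvPolynomial

noncomputable section

namespace SphereEq

/-! ### Generic minimal rigidity -/

section Rigidity

variable {V : Type*} [Fintype V] (G : SimpleGraph V) (d : ℕ)

/-- The space of infinitesimal motions of the framework `(G, p)` in `ℝ^d`: the velocities `q` with
`⟨p_u - p_v, q_u - q_v⟩ = 0` for every edge `uv` (the kernel of the rigidity matrix). -/
def infMotions (p : V → Fin d → ℝ) : Submodule ℝ (V → Fin d → ℝ) where
  carrier := {q | ∀ u v, G.Adj u v → ∑ i, (p u i - p v i) * (q u i - q v i) = 0}
  zero_mem' := by
    intro u v _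
    simp
  add_mem' := by
    intro a b ha hb u v h
    refine Eq.trans ?_ ((congrArg₂ (· + ·) (ha u v h) (hb u v h)).trans (add_zero 0))
    rw [← Finset.sum_add_distrib]
    refine Finset.sum_congr rfl fun i _ => ?_
    simp only [Pi.add_apply]
    ring
  smul_mem' := by
    intro c a ha u v h
    rw [← mul_zero c, ← ha u v h, Finset.mul_sum]
    refine Finset.sum_congr rfl fun i _ => ?_
    simp only [Pi.smul_apply, smul_eq_mul]
    ring

/-- Generic rigidity in `ℝ^d`, for graphs with at least `d` vertices: some (equivalently, almost
every) framework has only the infinitesimal motions that come from rigid motions of `ℝ^d`, a space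
of dimension `d (d + 1) / 2`. -/
def IsRigid : Prop :=
  ∃ p : V → Fin d → ℝ, Module.finrank ℝ (infMotions G d p) = (d + 1).choose 2

/-- Generic minimal rigidity: the graph is rigid, and deleting any edge destroys rigidity. -/
def IsMinimallyRigid : Prop :=
  IsRigid G d ∧ ∀ e ∈ G.edgeSet, ¬ IsRigid (G.deleteEdges {e}) d

end Rigidity

/-! ### The sphere equations -/

section System

variable {V : Type*} [DecidableEq V] (G : SimpleGraph V) (K : Finset V) (d : ℕ)

/-- The vertices that are not fixed. -/
abbrev Free : Type _ := {v : V // v ∉ K}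

/-- The edges that are not edges of the complete graph on the fixed vertices. -/
abbrev FreeEdge : Type _ := {e : Sym2 V // e ∈ G.edgeSet ∧ ¬ ∀ v ∈ e, v ∈ K}

/-- The variables: each non-fixed vertex carries a block of `d + 1` of them. In `ℂ^d` the
variable `(u, i)` is the coordinate `x_{u,i}` for `i < d`, and `(u, Fin.last d)` is `s_u`;
on `S^d` all of them are coordinates. -/
abbrev Var : Type _ := Free K × Fin (d + 1)

/-- The parameters of a system: the coordinates of the fixed vertices in an `N`-dimensional space,
and the lengths of the edges outside the fixed complete graph. -/
abbrev Param (N : ℕ) : Type _ := ({v : V // v ∈ K} × Fin N) ⊕ FreeEdge G K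

variable {G K d}

/-- The edge equation `s_u + s_v - 2 ⟨X_u, X_v⟩ - l^2` of `e = {u, v}`. -/
def edgePoly {σ : Type*} {N : ℕ} (X : V → Fin N → MvPolynomial σ ℂ) (s : V → MvPolynomial σ ℂ)
    (l : ℝ) (e : Sym2 V) : MvPolynomial σ ℂ :=
  Sym2.lift ⟨fun u v => s u + s v - 2 * ∑ i, X u i * X v i, fun u v => by
    simp only [add_comm (s u), mul_comm (X u _)]⟩ e - C ((l : ℂ) ^ 2)

/-- The coordinates of a vertex in `ℂ^d`: constants if it is fixed, variables otherwise. -/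
def euclCoord (θ : Param G K d → ℝ) (u : V) (i : Fin d) : MvPolynomial (Var K d) ℂ :=
  if h : u ∈ K then C ((θ (Sum.inl (⟨u, h⟩, i)) : ℝ) : ℂ) else X (⟨u, h⟩, i.castSucc)

/-- The squared magnitude `s_u` of a vertex: a constant if it is fixed, a variable otherwise. -/
def euclSq (θ : Param G K d → ℝ) (u : V) : MvPolynomial (Var K d) ℂ :=
  if h : u ∈ K then C ((∑ i, θ (Sum.inl (⟨u, h⟩, i)) ^ 2 : ℝ) : ℂ) else X (⟨u, h⟩, Fin.last d)

/-- The sphere equations for embeddings in `ℂ^d`: one magnitude equation for each non-fixed vertex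
and one edge equation for each edge outside the fixed complete graph. -/
def euclSystem (θ : Param G K d → ℝ) : Free K ⊕ FreeEdge G K → MvPolynomial (Var K d) ℂ
  | Sum.inl u => ∑ i, euclCoord θ u i ^ 2 - euclSq θ u
  | Sum.inr e => edgePoly (euclCoord θ) (euclSq θ) (θ (Sum.inr e)) e

/-- The `d + 1` coordinates of a vertex on the sphere `S^d`. -/
def sphCoord (θ : Param G K (d + 1) → ℝ) (u : V) (i : Fin (d + 1)) : MvPolynomial (Var K d) ℂ :=
  if h : u ∈ K then C ((θ (Sum.inl (⟨u, h⟩, i)) : ℝ) : ℂ) else X (⟨u, h⟩, i)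

/-- The sphere equations for embeddings on the unit sphere `S^d`, where `s_u = 1`. -/
def sphSystem (θ : Param G K (d + 1) → ℝ) : Free K ⊕ FreeEdge G K → MvPolynomial (Var K d) ℂ
  | Sum.inl u => ∑ i, sphCoord θ u i ^ 2 - 1
  | Sum.inr e => edgePoly (sphCoord θ) (fun _ => 1) (θ (Sum.inr e)) e

variable (G K d)

/-- The admissible parameters in `ℂ^d`: positive edge lengths. (The fixed points are arbitrary;
their mutual distances are the lengths of the edges of the fixed complete graph.) -/
def euclParams : Set (Param G K d → ℝ) :=
  {θ | ∀ e, 0 < θ (Sum.inr e)}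

/-- The admissible parameters on `S^d`: positive edge lengths, fixed points on the unit sphere. -/
def sphParams : Set (Param G K (d + 1) → ℝ) :=
  {θ | (∀ e, 0 < θ (Sum.inr e)) ∧ ∀ v, ∑ i, θ (Sum.inl (v, i)) ^ 2 = 1}

end System

/-- `P` holds for generic points of the (irreducible) set `S` of parameters: at all points of `S`
where a suitable polynomial, not identically zero on `S`, does not vanish. -/
def HoldsGenerically {ι : Type*} (S : Set (ι → ℝ)) (P : (ι → ℝ) → Prop) : Prop :=
  ∃ Φ : MvPolynomial ι ℝ, (∃ θ ∈ S, eval θ Φ ≠ 0) ∧ ∀ θ ∈ S, eval θ Φ ≠ 0 → P θ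

/-! ### Face systems -/

section Face

/-- The inner product of an exponent vector with `w`. -/
def weight {σ : Type*} [Fintype σ] (w : σ → ℝ) (β : σ →₀ ℕ) : ℝ := ∑ a, (β a : ℝ) * w a

open scoped Classical in
/-- The initial form `f^w`: the sum of the terms of `f` whose exponent vectors minimize the inner
product with `w`, i.e. lie on the face of the Newton polytope of `f` with inner normal `w`. -/
def initialForm {σ : Type*} [Fintype σ] (w : σ → ℝ) (f : MvPolynomial σ ℂ) : MvPolynomial σ ℂ :=
  ∑ β ∈ f.support with ∀ γ ∈ f.support, weight w β ≤ weight w γ, monomial β (coeff β f)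

variable {U : Type*} [Fintype U] [DecidableEq U] {d : ℕ}

/-- The coordinate normal `e_a`. -/
def coordNormal (a : U × Fin (d + 1)) : U × Fin (d + 1) → ℝ := Pi.single a 1

/-- The non-coordinate normal `δ_u`: `-1` on the block of `u`, and `0` elsewhere. -/
def deltaNormal (u : U) : U × Fin (d + 1) → ℝ := fun a => if a.1 = u then -1 else 0

/-- The face normals: the nonzero sums of distinct facet normals `e_a` and `δ_u`. -/
def IsFaceNormal (w : U × Fin (d + 1) → ℝ) : Prop :=
  w ≠ 0 ∧ ∃ (A : Finset (U × Fin (d + 1))) (D : Finset U),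
    w = ∑ a ∈ A, coordNormal a + ∑ u ∈ D, deltaNormal u

/-- For some face normal `w`, the face system `F^w` has a root in the torus. -/
def HasToricFaceRoot {κ : Type*} (F : κ → MvPolynomial (U × Fin (d + 1)) ℂ) : Prop :=
  ∃ w : U × Fin (d + 1) → ℝ, IsFaceNormal w ∧
    ∃ x : U × Fin (d + 1) → ℂ, (∀ a, x a ≠ 0) ∧ ∀ k, eval x (initialForm w (F k)) = 0

/-! ### The transformed system -/

/-- The degree of `f` in the block of variables of `u`. -/
def blockDegree (f : MvPolynomial (U × Fin (d + 1)) ℂ) (u : U) : ℕ :=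
  f.support.sup fun β => ∑ j, β (u, j)

/-- The transformed polynomial of `f` for the choice `L` of `δ`-variables `(u, L u)`: substitute
`x_{u,L u} = 1 / t_{u,L u}` and `x_{u,j} = t_{u,j} / t_{u,L u}` for `j ≠ L u`, which turns `x^β`
into the Laurent monomial with exponent `-∑ j, β (u, j)` at `(u, L u)` and `β (u, j)` at the other
`(u, j)`; then clear denominators, multiplying by `t_{u,L u} ^ blockDegree f u` for every `u`. -/
def transform (L : U → Fin (d + 1)) (f : MvPolynomial (U × Fin (d + 1)) ℂ) :
    MvPolynomial (U × Fin (d + 1)) ℂ :=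
  ∑ β ∈ f.support, monomial
    (Finsupp.equivFunOnFinite.symm fun a : U × Fin (d + 1) =>
      if a.2 = L a.1 then blockDegree f a.1 - ∑ j, β (a.1, j) else β a) (coeff β f)

/-- The transformed system has a solution at which some `δ`-variable vanishes. -/
def HasZeroDeltaRoot {κ : Type*} (L : U → Fin (d + 1))
    (F : κ → MvPolynomial (U × Fin (d + 1)) ℂ) : Prop :=
  ∃ t : U × Fin (d + 1) → ℂ, (∀ k, eval t (transform L (F k)) = 0) ∧ ∃ u, t (u, L u) = 0

end Face

end SphereEq

end

/-! Both conditions describe roots at infinity once each block `X_u` gets its own homogenizing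
variable `z_u`. Let `F^h(z, x)` be the multihomogenization (`homEval`), which can be rescaled block
by block (`homEval_smul`). The transformed system for `L` is `F^h` restricted to `x_{u,L(u)} = 1`,
with `z_u` in the role of the `δ`-variable (`eval_transform`).

A torus root `y` of `F^w` becomes a root of `F^h` when the coordinates at which `w` is not minimal
in its block are replaced by `0`, and `z_u` is `0` on the blocks where `w` takes the value `-1` and
`1` elsewhere (`homEval_face_eq_zero`). Two obstacles remain on the way to a transformed system.
Every block needs an admissible coordinate of minimal weight; without one, the initial form of its
magnitude equation is a monomial, which has no torus root. And if no block is negative, the root is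
an ordinary solution with a vanishing coordinate. A dimension count excludes this for generic
parameters: rigidity gives at least `d` edges outside `K` per free vertex, so configurations with a
vanishing coordinate form a hypersurface in a space of dimension at most the number of parameters
(`exists_dvd_aeval`).

Conversely, a solution with a zero `δ`-variable gives a root of `F^h` with `z_u = 0` exactly on a
nonempty set `D`, and with a nonzero coordinate in each block. If all its coordinates were nonzero,
it would be a torus root of `F^w` for `w = ∑ u ∈ D, δ_u` (`eval_initialForm_delta`). By Chevalley's
theorem, the parameters admitting such a torus root contain a nonempty open set or lie in a
hypersurface `Φ = 0` (`solvable_dichotomy`). In the first case generic parameters have one. In the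
second, suppose that a parameter has a root that is nonzero in each block. Generic reflections,
preceded in the Euclidean case by a generic translation that makes `s_u ≠ 0`, carry it into the
torus, so `Φ` vanishes at the moved parameters; specializing the motion shows that `Φ` vanishes at
the original parameter as well. Hence generic parameters have no such root at all.

Admissible spherical parameters do not fill an affine space. The argument therefore runs with
arbitrary magnitudes, and a scaling of the vertices transports it to the unit sphere
(`sphHom_scale`). -/

noncomputable section

namespace SphereEq

/-! ### Generic points of affine space -/

section Generic

/-- Finitely many polynomials, none of them zero, are simultaneously nonzero at some point with
coordinates in prescribed infinite sets. -/
theorem exists_forall_eval_ne_zero {k σ ι : Type*} [Field k] [Finite ι]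
    (f : ι → MvPolynomial σ k) (hf : ∀ i, f i ≠ 0) (s : σ → Set k) (hs : ∀ a, (s a).Infinite) :
    ∃ x : σ → k, (∀ a, x a ∈ s a) ∧ ∀ i, eval x (f i) ≠ 0 := by
  have := Fintype.ofFinite ι
  by_contra! h
  have h0 : ∏ i, f i = 0 := by
    refine funext_set s hs fun x hx => ?_
    obtain ⟨i, hi⟩ := h x fun a => hx a (Set.mem_univ a)
    rw [map_prod, map_zero]
    exact Finset.prod_eq_zero (Finset.mem_univ i) hi
  obtain ⟨i, -, hi⟩ := Finset.prod_eq_zero_iff.1 h0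
  exact hf i hi

/-- Finitely many polynomials, each nonzero somewhere, are simultaneously nonzero at a point. -/
theorem exists_common_eval_ne_zero {σ ι : Type*} [Finite ι] (f : ι → MvPolynomial σ ℂ)
    (hf : ∀ i, ∃ x, eval x (f i) ≠ 0) : ∃ x : σ → ℂ, ∀ i, eval x (f i) ≠ 0 := by
  obtain ⟨x, -, hx⟩ := exists_forall_eval_ne_zero f
    (fun i h => by obtain ⟨x, hx⟩ := hf i; simp [h] at hx) (fun _ => Set.univ)
    (fun _ => Set.infinite_univ)
  exact ⟨x, hx⟩

theorem eval_ofReal {σ : Type*} (x : σ → ℝ) (Φ : MvPolynomial σ ℝ) :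
    eval (fun a => (x a : ℂ)) (map Complex.ofRealHom Φ) = (eval x Φ : ℝ) := by
  have := eval_map (f := Complex.ofRealHom) (g := fun a => (x a : ℂ)) (p := Φ)
  rw [this]
  exact (eval₂_comp_left Complex.ofRealHom (RingHom.id ℝ) x Φ).symm

/-- A complex polynomial is the sum of a real polynomial and `i` times a real polynomial. -/
theorem exists_real_imag {σ : Type*} (Φ : MvPolynomial σ ℂ) : ∃ P Q : MvPolynomial σ ℝ,
    Φ = map Complex.ofRealHom P + C Complex.I * map Complex.ofRealHom Q := by
  induction Φ using MvPolynomial.induction_on with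
  | C a =>
    refine ⟨C a.re, C a.im, ?_⟩
    rw [map_C, map_C, ← C_mul, ← C_add]
    congr 1
    rw [mul_comm]
    exact (Complex.re_add_im a).symm
  | add p q hp hq =>
    obtain ⟨P, Q, rfl⟩ := hp
    obtain ⟨P', Q', rfl⟩ := hq
    exact ⟨P + P', Q + Q', by simp only [map_add]; ring⟩
  | mul_X p n hp =>
    obtain ⟨P, Q, rfl⟩ := hp
    exact ⟨P * X n, Q * X n, by simp only [map_mul, map_X]; ring⟩

/-- A complex polynomial that does not vanish at a real point can be replaced by a real one. -/
theorem exists_real_eval_ne_zero {σ : Type*} (Φ : MvPolynomial σ ℂ) (θ₀ : σ → ℝ)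
    (h : eval (fun a => (θ₀ a : ℂ)) Φ ≠ 0) : ∃ Ψ : MvPolynomial σ ℝ, eval θ₀ Ψ ≠ 0 ∧
      ∀ θ : σ → ℝ, eval θ Ψ ≠ 0 → eval (fun a => (θ a : ℂ)) Φ ≠ 0 := by
  obtain ⟨P, Q, rfl⟩ := exists_real_imag Φ
  have key : ∀ θ : σ → ℝ, eval (fun a => (θ a : ℂ))
      (map Complex.ofRealHom P + C Complex.I * map Complex.ofRealHom Q) = ⟨eval θ P, eval θ Q⟩ := by
    intro θ
    rw [map_add, map_mul, eval_C, eval_ofReal, eval_ofReal]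
    apply Complex.ext <;> simp
  by_cases hP : eval θ₀ P = 0
  · refine ⟨Q, fun hQ => h ?_, fun θ hθ h0 => hθ ?_⟩
    · rw [key, hP, hQ]; rfl
    · rw [key] at h0; exact congrArg Complex.im h0
  · refine ⟨P, hP, fun θ hθ h0 => hθ ?_⟩
    rw [key] at h0; exact congrArg Complex.re h0

/-- If there are at least as many polynomials `f i` as variables, then every nonzero polynomial `g`
divides some polynomial relation in the `f i`. -/
theorem exists_dvd_aeval {υ ι : Type*} [Fintype υ] [Fintype ι]
    (hcard : Fintype.card υ ≤ Fintype.card ι) (f : ι → MvPolynomial υ ℂ) (g : MvPolynomial υ ℂ)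
    (hg : g ≠ 0) : ∃ Ψ : MvPolynomial ι ℂ, Ψ ≠ 0 ∧ g ∣ aeval f Ψ := by
  -- Independent `f i` form a transcendence basis by the count, so `g` is algebraic over `ℂ[f]` and
  -- divides a nonzero element of it. Dependent `f i` satisfy a nontrivial relation, and `g` divides
  -- `0`.
  by_cases hf : AlgebraicIndependent ℂ f
  · have htb : IsTranscendenceBasis ℂ f := by
      refine hf.isTranscendenceBasis_of_lift_trdeg_le_of_finite ?_
      rw [MvPolynomial.trdeg_of_isDomain]
      simpa using hcard
    have := htb.isAlgebraic
    obtain ⟨⟨r, hr⟩, hr0, hd⟩ := (Algebra.IsAlgebraic.isAlgebraic (R := Algebra.adjoin ℂ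
      (Set.range f)) g).exists_nonzero_dvd (mem_nonZeroDivisors_of_ne_zero hg)
    rw [Algebra.adjoin_range_eq_range_aeval] at hr
    obtain ⟨Ψ, rfl⟩ := hr
    refine ⟨Ψ, fun h => hr0 ?_, hd⟩
    subst h
    exact Subtype.ext (map_zero _)
  · rw [algebraicIndependent_iff] at hf
    push Not at hf
    obtain ⟨Ψ, h0, hne⟩ := hf
    exact ⟨Ψ, hne, h0 ▸ dvd_zero g⟩

/-- A constructible subset of the spectrum of a domain contains a nonempty basic open set or is
contained in a proper closed set. -/
theorem constructible_dichotomy {R : Type*} [CommRing R] [IsDomain R] {Z : Set (PrimeSpectrum R)}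
    (hZ : Topology.IsConstructible Z) : ∃ Φ : R, Φ ≠ 0 ∧
      ((∀ p : PrimeSpectrum R, Φ ∉ p.asIdeal → p ∈ Z) ∨ ∀ p ∈ Z, Φ ∈ p.asIdeal) := by
  obtain ⟨S, rfl⟩ := PrimeSpectrum.exists_constructibleSetData_iff.2 hZ
  -- The set is a finite union of pieces `V(g) ∩ D(f)`. A piece with all `g i = 0` and `f ≠ 0` is a
  -- nonempty basic open set; any other piece is empty or lies in some `V(g i)` with `g i ≠ 0`.
  by_cases h : ∃ c ∈ S, c.f ≠ 0 ∧ ∀ i, c.g i = 0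
  · obtain ⟨c, hc, hf, hg⟩ := h
    refine ⟨c.f, hf, Or.inl fun p hp => Set.mem_biUnion hc ⟨?_, ?_⟩⟩
    · rintro _ ⟨i, rfl⟩
      simp [hg i]
    · simpa [PrimeSpectrum.mem_zeroLocus] using hp
  · push Not at h
    have h' : ∀ c : S, ∃ Φ : R, Φ ≠ 0 ∧ ∀ p ∈ c.1.toSet, Φ ∈ p.asIdeal := by
      rintro ⟨c, hc⟩
      by_cases hf : c.f = 0
      · refine ⟨1, one_ne_zero, fun p hp => absurd ?_ hp.2⟩
        simp [hf]
      · obtain ⟨i, hi⟩ := h c hc hf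
        exact ⟨c.g i, hi, fun p hp => hp.1 ⟨i, rfl⟩⟩
    choose Φ h0 hΦ using h'
    refine ⟨∏ c, Φ c, Finset.prod_ne_zero_iff.2 fun c _ => h0 c, Or.inr fun p hp => ?_⟩
    obtain ⟨c, hc, hpc⟩ := Set.mem_iUnion₂.1 hp
    exact Ideal.mem_of_dvd _ (Finset.dvd_prod_of_mem Φ (Finset.mem_univ ⟨c, hc⟩))
      (hΦ ⟨c, hc⟩ p hpc)

/-- The prime ideal of a point of affine space. -/
def pointIdeal {σ : Type*} (x : σ → ℂ) : PrimeSpectrum (MvPolynomial σ ℂ) :=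
  ⟨RingHom.ker (eval x), RingHom.ker_isPrime _⟩

/-- The set of parameters for which a system of polynomial equations and one inequation is solvable
contains a nonempty Zariski open set or is contained in a hypersurface. -/
theorem solvable_dichotomy {σ τ κ : Type*} [Finite σ] [Finite τ] [Finite κ]
    (f : κ → MvPolynomial (σ ⊕ τ) ℂ) (g : MvPolynomial (σ ⊕ τ) ℂ) :
    ∃ Φ : MvPolynomial σ ℂ, Φ ≠ 0 ∧
      ((∀ θ, eval θ Φ ≠ 0 → ∃ x : τ → ℂ, (∀ k, eval (Sum.elim θ x) (f k) = 0) ∧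
        eval (Sum.elim θ x) g ≠ 0) ∨
      ∀ θ, ∀ x : τ → ℂ, (∀ k, eval (Sum.elim θ x) (f k) = 0) →
        eval (Sum.elim θ x) g ≠ 0 → eval θ Φ = 0) := by
  let ρ : MvPolynomial σ ℂ →ₐ[ℂ] MvPolynomial (σ ⊕ τ) ℂ := rename Sum.inl
  have hρ : ρ.toRingHom.FinitePresentation := by
    refine (RingHom.FinitePresentation.of_finiteType (f := ρ.toRingHom)).1 ?_
    refine RingHom.FiniteType.of_comp_finiteType (f := (C : ℂ →+* MvPolynomial σ ℂ)) ?_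
    have : ρ.toRingHom.comp C = algebraMap ℂ (MvPolynomial (σ ⊕ τ) ℂ) := ρ.comp_algebraMap
    rw [this, RingHom.finiteType_algebraMap]
    infer_instance
  let s : Set (PrimeSpectrum (MvPolynomial (σ ⊕ τ) ℂ)) :=
    PrimeSpectrum.zeroLocus (Set.range f) \ PrimeSpectrum.zeroLocus {g}
  have hs : Topology.IsConstructible s := by
    rw [← PrimeSpectrum.exists_constructibleSetData_iff]
    refine ⟨{⟨g, Nat.card κ, fun i => f ((Finite.equivFin κ).symm i)⟩}, ?_⟩
    simp only [PrimeSpectrum.ConstructibleSetData.toSet, Finset.mem_singleton,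
      Set.iUnion_iUnion_eq_left, PrimeSpectrum.BasicConstructibleSetData.toSet, s]
    congr 2
    exact (Finite.equivFin κ).symm.surjective.range_comp f
  -- Chevalley's theorem for the projection that forgets the unknowns.
  obtain ⟨Φ, h0, h⟩ := constructible_dichotomy (PrimeSpectrum.isConstructible_comap_image hρ hs)
  have hρe : ∀ (θ : σ → ℂ) (x : τ → ℂ) p, eval (Sum.elim θ x) (ρ p) = eval θ p := fun θ x p => by
    simp [ρ, eval_rename]
  refine ⟨Φ, h0, h.imp (fun h θ hθ => ?_) (fun h θ x hf hg => ?_)⟩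
  · obtain ⟨q, hq, hqθ⟩ := h (pointIdeal θ) hθ
    have hgq : g ∉ q.asIdeal := fun hg => hq.2 (by simpa [PrimeSpectrum.mem_zeroLocus] using hg)
    have := q.isPrime
    -- By the Nullstellensatz the prime `q` above the point `θ` has a closed zero `y` with `g y ≠
    -- 0`; its parameter coordinates are `θ` because `q` contains every `X a - θ a`.
    rw [← IsPrime.vanishingIdeal_zeroLocus (K := ℂ) q.asIdeal, mem_vanishingIdeal_iff] at hgq
    push Not at hgq
    obtain ⟨y, hy, hgy⟩ := hgq
    have hyθ : y = Sum.elim θ (fun a => y (Sum.inr a)) := by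
      funext a
      rcases a with a | a
      · have hmem : ρ (X a - C (θ a)) ∈ q.asIdeal := by
          have : X a - C (θ a) ∈ (PrimeSpectrum.comap ρ.toRingHom q).asIdeal := by
            rw [hqθ]
            simp [pointIdeal, RingHom.mem_ker]
          exact this
        have := hy _ hmem
        simp only [map_sub, ρ, rename_X, rename_C, aeval_X, aeval_C] at this
        exact sub_eq_zero.1 this
      · rfl
    refine ⟨fun a => y (Sum.inr a), ?_, ?_⟩
    · rw [← hyθ]
      exact fun k => hy _ (hq.1 ⟨k, rfl⟩)
    · rwa [← hyθ]
  · refine h (pointIdeal θ) ⟨pointIdeal (Sum.elim θ x), ⟨?_, ?_⟩, ?_⟩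
    · rintro _ ⟨k, rfl⟩
      exact hf k
    · simpa [PrimeSpectrum.mem_zeroLocus, pointIdeal, RingHom.mem_ker] using hg
    · refine PrimeSpectrum.ext (Ideal.ext fun p => ?_)
      exact (RingHom.mem_ker.trans (by rw [← hρe θ x p]; rfl)).symm

end Generic

/-! ### Multihomogenization -/

section Homogenization

variable {U : Type*} [Fintype U] [DecidableEq U] {d : ℕ}

/-- The multihomogenization of `f` of multidegree `b`, with homogenizing variables `z`. -/
def homEval (b : U → ℕ) (f : MvPolynomial (U × Fin (d + 1)) ℂ) (z : U → ℂ)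
    (x : U × Fin (d + 1) → ℂ) : ℂ :=
  ∑ β ∈ f.support, coeff β f * ((∏ u, z u ^ (b u - ∑ j, β (u, j))) * ∏ a, x a ^ β a)

/-- The degree of `f` in the block of `u` is at most `b u`. -/
def BlockLE (b : U → ℕ) (f : MvPolynomial (U × Fin (d + 1)) ℂ) : Prop :=
  ∀ β ∈ f.support, ∀ u, ∑ j, β (u, j) ≤ b u

omit [Fintype U] [DecidableEq U] in
theorem blockLE_blockDegree (f : MvPolynomial (U × Fin (d + 1)) ℂ) : BlockLE (blockDegree f) f :=
  fun _ hβ u => Finset.le_sup (f := fun β : U × Fin (d + 1) →₀ ℕ => ∑ j, β (u, j)) hβ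

omit [Fintype U] [DecidableEq U] in
theorem BlockLE.mono {b b' : U → ℕ} {f : MvPolynomial (U × Fin (d + 1)) ℂ} (h : BlockLE b f)
    (hb : b ≤ b') : BlockLE b' f :=
  fun β hβ u => (h β hβ u).trans (hb u)

omit [Fintype U] in
theorem BlockLE.add {b : U → ℕ} {f g : MvPolynomial (U × Fin (d + 1)) ℂ} (hf : BlockLE b f)
    (hg : BlockLE b g) : BlockLE b (f + g) := fun β hβ => by
  rcases Finset.mem_union.1 (support_add hβ) with h | h
  exacts [hf β h, hg β h]

omit [Fintype U] in
theorem BlockLE.sub {b : U → ℕ} {f g : MvPolynomial (U × Fin (d + 1)) ℂ} (hf : BlockLE b f)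
    (hg : BlockLE b g) : BlockLE b (f - g) := fun β hβ => by
  rcases Finset.mem_union.1 (support_sub _ f g hβ) with h | h
  exacts [hf β h, hg β h]

omit [Fintype U] in
theorem BlockLE.mul {b b' : U → ℕ} {f g : MvPolynomial (U × Fin (d + 1)) ℂ} (hf : BlockLE b f)
    (hg : BlockLE b' g) : BlockLE (b + b') (f * g) := fun β hβ u => by
  obtain ⟨β₁, h₁, β₂, h₂, rfl⟩ := Finset.mem_add.1 (support_mul f g hβ)
  simp only [Finsupp.add_apply, Finset.sum_add_distrib]
  exact add_le_add (hf _ h₁ u) (hg _ h₂ u)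

omit [Fintype U] [DecidableEq U] in
theorem blockLE_C (b : U → ℕ) (c : ℂ) : BlockLE (d := d) b (C c) := fun β hβ u => by
  classical
  rw [mem_support_iff, coeff_C] at hβ
  obtain rfl : 0 = β := by by_contra h; simp [h] at hβ
  simp

omit [Fintype U] in
theorem blockLE_X (a : U × Fin (d + 1)) : BlockLE (Pi.single a.1 1) (X a) := fun β hβ u => by
  rw [support_X, Finset.mem_singleton] at hβ
  subst hβ
  obtain ⟨v, i⟩ := a
  by_cases h : v = u
  · subst h
    simp [Finsupp.single_apply]
  · have : ∀ j, (v, i) ≠ (u, j) := fun j hj => h (congrArg Prod.fst hj)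
    simp [this]

omit [Fintype U] in
theorem BlockLE.sum {ι : Type*} {b : U → ℕ} {s : Finset ι}
    {f : ι → MvPolynomial (U × Fin (d + 1)) ℂ} (hf : ∀ i ∈ s, BlockLE b (f i)) :
    BlockLE b (∑ i ∈ s, f i) := by
  classical
  induction s using Finset.induction_on with
  | empty => simpa using blockLE_C (d := d) b 0
  | insert i s hi ih =>
    rw [Finset.sum_insert hi]
    exact (hf i (Finset.mem_insert_self i s)).add
      (ih fun j hj => hf j (Finset.mem_insert_of_mem hj))

omit [DecidableEq U] in
/-- The values of the transformed polynomial are values of the multihomogenization. -/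
theorem eval_transform (L : U → Fin (d + 1)) (f : MvPolynomial (U × Fin (d + 1)) ℂ)
    (t : U × Fin (d + 1) → ℂ) : eval t (transform L f) =
      homEval (blockDegree f) f (fun u => t (u, L u)) (fun a => if a.2 = L a.1 then 1 else t a) := by
  rw [transform, map_sum, homEval]
  refine Finset.sum_congr rfl fun β _ => ?_
  rw [eval_monomial, Finsupp.prod_fintype _ _ fun _ => pow_zero _, Fintype.prod_prod_type,
    Fintype.prod_prod_type, ← Finset.prod_mul_distrib]
  congr 1
  refine Finset.prod_congr rfl fun u _ => ?_
  rw [← Finset.mul_prod_erase _ _ (Finset.mem_univ (L u)),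
    ← Finset.mul_prod_erase _ _ (Finset.mem_univ (L u))]
  simp only [Finsupp.equivFunOnFinite_symm_apply_apply, if_true, one_pow, one_mul]
  congr 1
  refine Finset.prod_congr rfl fun j hj => ?_
  simp [Finset.ne_of_mem_erase hj]

omit [DecidableEq U] in
-- Every term has total degree `b u` in `z_u` and the block of `u` together; the bound `hf` keeps
-- the truncated subtraction honest.
theorem homEval_smul {b : U → ℕ} {f : MvPolynomial (U × Fin (d + 1)) ℂ} (hf : BlockLE b f)
    (c z : U → ℂ) (x : U × Fin (d + 1) → ℂ) :
    homEval b f (fun u => c u * z u) (fun a => c a.1 * x a) = (∏ u, c u ^ b u) * homEval b f z x := by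
  rw [homEval, homEval, Finset.mul_sum]
  refine Finset.sum_congr rfl fun β hβ => ?_
  have h : ∏ u, c u ^ b u
      = (∏ u, c u ^ (b u - ∑ j, β (u, j))) * ∏ a : U × Fin (d + 1), c a.1 ^ β a := by
    rw [Fintype.prod_prod_type, ← Finset.prod_mul_distrib]
    refine Finset.prod_congr rfl fun u _ => ?_
    change _ = _ * ∏ j, c u ^ β (u, j)
    rw [Finset.prod_pow_eq_pow_sum, ← pow_add, Nat.sub_add_cancel (hf β hβ u)]
  simp only [mul_pow, Finset.prod_mul_distrib]
  rw [h]
  ring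

omit [DecidableEq U] in
theorem homEval_one (b : U → ℕ) (f : MvPolynomial (U × Fin (d + 1)) ℂ)
    (x : U × Fin (d + 1) → ℂ) : homEval b f (fun _ => 1) x = eval x f := by
  simp [homEval, eval_eq']

omit [DecidableEq U] in
theorem continuous_homEval (b : U → ℕ) (f : MvPolynomial (U × Fin (d + 1)) ℂ)
    (x : U × Fin (d + 1) → ℂ) : Continuous fun z => homEval b f z x := by
  unfold homEval
  fun_prop

omit [DecidableEq U] in
/-- A continuous function that agrees with the multihomogenization where the homogenizing variables
do not vanish agrees with it everywhere. -/
theorem homEval_eq {b : U → ℕ} {f : MvPolynomial (U × Fin (d + 1)) ℂ} (hf : BlockLE b f)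
    {x : U × Fin (d + 1) → ℂ} {F : (U → ℂ) → ℂ} (hF : Continuous F)
    (h : ∀ z, (∀ u, z u ≠ 0) → F z = (∏ u, z u ^ b u) * eval (fun a => (z a.1)⁻¹ * x a) f)
    (z : U → ℂ) : homEval b f z x = F z := by
  have hd : Dense {z : U → ℂ | ∀ u, z u ≠ 0} := by
    have := dense_pi (Set.univ : Set U) (s := fun _ => {c : ℂ | c ≠ 0})
      fun _ _ => dense_compl_singleton (0 : ℂ)
    simpa [Set.pi] using this
  refine congrFun (Continuous.ext_on hd (continuous_homEval b f x) hF fun z hz => ?_) z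
  have := homEval_smul hf z (fun u => (z u)⁻¹ * z u) (fun a => (z a.1)⁻¹ * x a)
  simp only [inv_mul_cancel₀ (hz _), mul_inv_cancel_left₀ (hz _), homEval_one, mul_one] at this
  change homEval b f z x = F z
  rw [h z hz, this]

omit [DecidableEq U] in
/-- A multidegree bound is attained by a single monomial if the multihomogenization does not vanish
at infinity. -/
theorem exists_attained {b : U → ℕ} {f : MvPolynomial (U × Fin (d + 1)) ℂ} (hf : BlockLE b f)
    {x : U × Fin (d + 1) → ℂ} (h : homEval b f (fun _ => 0) x ≠ 0) :
    blockDegree f = b ∧ ∃ β ∈ f.support, ∀ u, ∑ j, β (u, j) = b u := by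
  obtain ⟨β, hβ, h0⟩ := Finset.exists_ne_zero_of_sum_ne_zero h
  have hb : ∀ u, ∑ j, β (u, j) = b u := fun u => by
    by_contra hne
    refine h0 ?_
    have : b u - ∑ j, β (u, j) ≠ 0 := by have := hf β hβ u; omega
    rw [Finset.prod_eq_zero (Finset.mem_univ u) (zero_pow this), zero_mul, mul_zero]
  refine ⟨funext fun u => le_antisymm (Finset.sup_le fun γ hγ => hf γ hγ u) ?_, β, hβ, hb⟩
  rw [← hb u]
  exact blockLE_blockDegree f β hβ u

end Homogenization

/-! ### Initial forms along face normals -/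

section Faces

variable {U : Type*} [Fintype U] [DecidableEq U] {d : ℕ}

omit [DecidableEq U] in
theorem eval_initialForm (w : U × Fin (d + 1) → ℝ) (f : MvPolynomial (U × Fin (d + 1)) ℂ)
    (y : U × Fin (d + 1) → ℂ) [DecidablePred fun β => ∀ γ ∈ f.support, weight w β ≤ weight w γ] :
    eval y (initialForm w f) = ∑ β ∈ f.support with ∀ γ ∈ f.support, weight w β ≤ weight w γ,
      coeff β f * ∏ a, y a ^ β a := by
  rw [initialForm, map_sum]
  refine Finset.sum_congr (Finset.filter_congr_decidable _ _ _) fun β _ => ?_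
  rw [eval_monomial, Finsupp.prod_fintype _ _ fun _ => pow_zero _]

/-- An initial form that consists of one monomial has no root in the torus. -/
theorem eval_initialForm_ne_zero {w : U × Fin (d + 1) → ℝ}
    {f : MvPolynomial (U × Fin (d + 1)) ℂ} {β : U × Fin (d + 1) →₀ ℕ} (hβ : β ∈ f.support)
    (h : ∀ γ ∈ f.support, γ ≠ β → weight w β < weight w γ) {y : U × Fin (d + 1) → ℂ}
    (hy : ∀ a, y a ≠ 0) : eval y (initialForm w f) ≠ 0 := by
  classical
  have : (f.support.filter fun β => ∀ γ ∈ f.support, weight w β ≤ weight w γ) = {β} := by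
    ext γ
    simp only [Finset.mem_filter, Finset.mem_singleton]
    refine ⟨fun hγ => ?_, ?_⟩
    · by_contra hne
      exact absurd (hγ.2 β hβ) (not_le.2 (h γ hγ.1 hne))
    · rintro rfl
      refine ⟨hβ, fun δ hδ => ?_⟩
      by_cases hne : δ = γ
      · rw [hne]
      · exact (h δ hδ hne).le
  rw [eval_initialForm, this, Finset.sum_singleton]
  exact mul_ne_zero (mem_support_iff.1 hβ) (Finset.prod_ne_zero_iff.2 fun a _ => pow_ne_zero _ (hy a))

/-- The block values of `w`: minus one on the blocks in `D`, zero on the others. -/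
def blockMin (D : Finset U) (u : U) : ℝ := if u ∈ D then -1 else 0

/-- The values of the multihomogenization at the point at infinity determined by a torus point
`y` and a face normal `w` collect the monomials of weight `∑ u, blockMin D u * b u`. -/
theorem homEval_face {D : Finset U} {w : U × Fin (d + 1) → ℝ}
    (hw : ∀ a, blockMin D a.1 ≤ w a) {b : U → ℕ} {f : MvPolynomial (U × Fin (d + 1)) ℂ}
    (hf : BlockLE b f) (y : U × Fin (d + 1) → ℂ) :
    (∀ β ∈ f.support, ∑ u, blockMin D u * b u ≤ weight w β) ∧
    homEval b f (fun u => if u ∈ D then 0 else 1)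
      (fun a => if w a = blockMin D a.1 then y a else 0) =
      ∑ β ∈ f.support with weight w β = ∑ u, blockMin D u * b u, coeff β f * ∏ a, y a ^ β a := by
  -- The excess weight of a monomial is a sum of nonnegative terms, one per coordinate and one per
  -- block. It is zero exactly when the monomial avoids the coordinates set to `0` and has full
  -- degree in the blocks of `D`, that is, when no factor of its homogenization is killed.
  have key : ∀ β, weight w β - ∑ u, blockMin D u * b u
      = ∑ a : U × Fin (d + 1), (β a : ℝ) * (w a - blockMin D a.1)
        + ∑ u, -blockMin D u * ((b u : ℝ) - ∑ j, (β (u, j) : ℝ)) := by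
    intro β
    have h1 : ∑ a : U × Fin (d + 1), (β a : ℝ) * (w a - blockMin D a.1)
        = weight w β - ∑ u, blockMin D u * ∑ j, (β (u, j) : ℝ) := by
      rw [weight]
      simp only [mul_sub, Finset.sum_sub_distrib]
      congr 1
      rw [Fintype.sum_prod_type]
      refine Finset.sum_congr rfl fun u _ => ?_
      rw [Finset.mul_sum]
      exact Finset.sum_congr rfl fun j _ => mul_comm _ _
    have h2 : ∑ u, -blockMin D u * ((b u : ℝ) - ∑ j, (β (u, j) : ℝ))
        = ∑ u, blockMin D u * ∑ j, (β (u, j) : ℝ) - ∑ u, blockMin D u * b u := by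
      rw [← Finset.sum_sub_distrib]
      exact Finset.sum_congr rfl fun u _ => by ring
    rw [h1, h2]
    ring
  have hpos1 : ∀ β : U × Fin (d + 1) →₀ ℕ, ∀ a : U × Fin (d + 1),
      0 ≤ (β a : ℝ) * (w a - blockMin D a.1) :=
    fun β a => mul_nonneg (Nat.cast_nonneg _) (sub_nonneg.2 (hw a))
  have hm : ∀ u, 0 ≤ -blockMin D u := fun u => by
    unfold blockMin; split_ifs <;> norm_num
  have hle : ∀ β ∈ f.support, ∀ u, 0 ≤ (b u : ℝ) - ∑ j, (β (u, j) : ℝ) := fun β hβ u => by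
    rw [sub_nonneg]
    exact_mod_cast hf β hβ u
  have hpos2 : ∀ β ∈ f.support, ∀ u, 0 ≤ -blockMin D u * ((b u : ℝ) - ∑ j, (β (u, j) : ℝ)) :=
    fun β hβ u => mul_nonneg (hm u) (hle β hβ u)
  refine ⟨fun β hβ => ?_, ?_⟩
  · rw [← sub_nonneg, key]
    exact add_nonneg (Finset.sum_nonneg fun a _ => hpos1 β a)
      (Finset.sum_nonneg fun u _ => hpos2 β hβ u)
  · rw [homEval, Finset.sum_filter]
    refine Finset.sum_congr rfl fun β hβ => ?_
    split_ifs with h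
    · rw [← sub_eq_zero, key, add_eq_zero_iff_of_nonneg (Finset.sum_nonneg fun a _ => hpos1 β a)
        (Finset.sum_nonneg fun u _ => hpos2 β hβ u),
        Finset.sum_eq_zero_iff_of_nonneg fun a _ => hpos1 β a,
        Finset.sum_eq_zero_iff_of_nonneg fun u _ => hpos2 β hβ u] at h
      have h1 : ∏ u, (if u ∈ D then (0 : ℂ) else 1) ^ (b u - ∑ j, β (u, j)) = 1 := by
        refine Finset.prod_eq_one fun u _ => ?_
        split_ifs with hu
        · have := h.2 u (Finset.mem_univ u)
          simp only [blockMin, hu, if_true, neg_neg, one_mul, sub_eq_zero] at this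
          have : b u = ∑ j, β (u, j) := by exact_mod_cast this
          rw [← this, Nat.sub_self, pow_zero]
        · exact one_pow _
      have h2 : ∏ a, (if w a = blockMin D a.1 then y a else 0) ^ β a = ∏ a, y a ^ β a := by
        refine Finset.prod_congr rfl fun a _ => ?_
        split_ifs with ha
        · rfl
        · have := h.1 a (Finset.mem_univ a)
          rcases mul_eq_zero.1 this with h0 | h0
          · rw [Nat.cast_eq_zero.1 h0, pow_zero, pow_zero]
          · exact absurd (sub_eq_zero.1 h0) ha
      rw [h1, h2, one_mul]
    · refine mul_eq_zero_of_right _ ?_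
      by_contra hne
      obtain ⟨hz, hx⟩ := mul_ne_zero_iff.1 hne
      refine h (sub_eq_zero.1 ?_)
      rw [key]
      refine (congrArg₂ (· + ·) (Finset.sum_eq_zero fun a _ => ?_)
        (Finset.sum_eq_zero fun u _ => ?_)).trans (add_zero 0)
      · have := Finset.prod_ne_zero_iff.1 hx a (Finset.mem_univ a)
        by_cases ha : w a = blockMin D a.1
        · rw [ha, sub_self, mul_zero]
        · rw [if_neg ha] at this
          rw [show β a = 0 by by_contra h0; exact this (zero_pow h0), Nat.cast_zero, zero_mul]
      · have := Finset.prod_ne_zero_iff.1 hz u (Finset.mem_univ u)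
        by_cases hu : u ∈ D
        · rw [if_pos hu] at this
          have h0 : b u - ∑ j, β (u, j) = 0 := by by_contra h0; exact this (zero_pow h0)
          have : b u = ∑ j, β (u, j) := le_antisymm (Nat.sub_eq_zero_iff_le.1 h0) (hf β hβ u)
          rw [this]
          push_cast
          ring
        · rw [blockMin, if_neg hu, neg_zero, zero_mul]

/-- A torus root of an initial form gives a root of the multihomogenization. -/
theorem homEval_face_eq_zero {D : Finset U} {w : U × Fin (d + 1) → ℝ}
    (hw : ∀ a, blockMin D a.1 ≤ w a) {b : U → ℕ} {f : MvPolynomial (U × Fin (d + 1)) ℂ}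
    (hf : BlockLE b f) {y : U × Fin (d + 1) → ℂ} (hy : eval y (initialForm w f) = 0) :
    homEval b f (fun u => if u ∈ D then 0 else 1)
      (fun a => if w a = blockMin D a.1 then y a else 0) = 0 := by
  classical
  obtain ⟨hle, heq⟩ := homEval_face hw hf y
  rw [heq]
  -- If the lower bound is attained, the surviving terms are the initial form; otherwise none
  -- survive.
  by_cases h : ∃ β ∈ f.support, weight w β = ∑ u, blockMin D u * b u
  · rw [eval_initialForm] at hy
    refine Eq.trans (Finset.sum_congr (Finset.filter_congr fun β hβ => ?_) fun _ _ => rfl) hy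
    obtain ⟨β₀, h₀, he⟩ := h
    refine ⟨fun hβ' γ hγ => hβ' ▸ hle γ hγ, fun h => le_antisymm ?_ (hle β hβ)⟩
    rw [← he]
    exact h β₀ h₀
  · push Not at h
    rw [Finset.filter_false_of_mem h, Finset.sum_empty]

/-- The initial form along `∑ u ∈ D, δ_u` is the multihomogenization at infinity, if the
multidegree is attained. -/
theorem eval_initialForm_delta (D : Finset U) {b : U → ℕ} {f : MvPolynomial (U × Fin (d + 1)) ℂ}
    (hf : BlockLE b f) (hb : ∃ β ∈ f.support, ∀ u, ∑ j, β (u, j) = b u)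
    (y : U × Fin (d + 1) → ℂ) :
    eval y (initialForm (fun a => blockMin D a.1) f) =
      homEval b f (fun u => if u ∈ D then 0 else 1) y := by
  classical
  obtain ⟨hle, heq⟩ := homEval_face (D := D) (w := fun a => blockMin D a.1) (fun a => le_rfl) hf y
  simp only [if_true] at heq
  rw [heq, eval_initialForm]
  refine Finset.sum_congr (Finset.filter_congr fun β hβ => ?_) fun _ _ => rfl
  obtain ⟨β₀, h₀, he⟩ := hb
  have he' : weight (fun a : U × Fin (d + 1) => blockMin D a.1) β₀ = ∑ u, blockMin D u * b u := by
    rw [weight, Fintype.sum_prod_type]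
    refine Finset.sum_congr rfl fun u _ => ?_
    change ∑ j, (β₀ (u, j) : ℝ) * blockMin D u = _
    rw [← he u, ← Finset.sum_mul]
    push_cast
    ring
  refine ⟨fun h => le_antisymm ?_ (hle β hβ), fun hβ' γ hγ => hβ' ▸ hle γ hγ⟩
  rw [← he']
  exact h β₀ h₀

omit [Fintype U] in
theorem sum_deltaNormal (D : Finset U) :
    (∑ u ∈ D, deltaNormal u : U × Fin (d + 1) → ℝ) = fun a => blockMin D a.1 := by
  funext a
  simp only [Finset.sum_apply, deltaNormal, blockMin]
  rw [Finset.sum_ite_eq D a.1]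

omit [Fintype U] in
theorem isFaceNormal_blockMin {D : Finset U} (hD : D.Nonempty) :
    IsFaceNormal (fun a : U × Fin (d + 1) => blockMin D a.1) := by
  refine ⟨fun h => ?_, ∅, D, ?_⟩
  · obtain ⟨u, hu⟩ := hD
    have := congrFun h (u, 0)
    simp [blockMin, hu] at this
  · rw [Finset.sum_empty, zero_add, sum_deltaNormal]

omit [Fintype U] in
/-- Every block of a face normal has its values in `{0, -1}` or in `{0, 1}`. -/
theorem IsFaceNormal.exists_blocks {w : U × Fin (d + 1) → ℝ} (hw : IsFaceNormal w) :
    ∃ D : Finset U, (∀ u ∈ D, ∃ j, w (u, j) = -1) ∧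
      ∀ a, w a = blockMin D a.1 ∨ w a = blockMin D a.1 + 1 := by
  classical
  obtain ⟨-, A, E, rfl⟩ := hw
  have hval : ∀ a : U × Fin (d + 1), (∑ a ∈ A, coordNormal a + ∑ u ∈ E, deltaNormal u : U × Fin (d + 1) → ℝ) a
      = (if a ∈ A then 1 else 0) + blockMin E a.1 := by
    intro a
    rw [sum_deltaNormal, Pi.add_apply, Finset.sum_apply]
    congr 1
    simp only [coordNormal, Pi.single_apply]
    rw [Finset.sum_ite_eq A a]
  -- A block in which `δ_u` is cancelled by all the `e_{u,j}` is zero and must not be counted as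
  -- negative.
  refine ⟨E.filter fun u => ∃ j, (u, j) ∉ A, fun u hu => ?_, fun a => ?_⟩
  · obtain ⟨huE, j, hj⟩ := Finset.mem_filter.1 hu
    refine ⟨j, ?_⟩
    rw [hval, if_neg hj, blockMin, if_pos huE, zero_add]
  · rw [hval]
    unfold blockMin
    by_cases hE : a.1 ∈ E <;> by_cases hA : a ∈ A <;> by_cases hj : ∃ j, (a.1, j) ∉ A <;>
      simp [hE, hA, hj]
    exact (hj ⟨a.2, hA⟩).elim

/-- A toric root of a face system gives a solution of a transformed system at infinity, unless the
system has a solution with a vanishing coordinate. -/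
theorem exists_hasZeroDeltaRoot {κ : Type*} {F : κ → MvPolynomial (U × Fin (d + 1)) ℂ}
    {P : Fin (d + 1) → Prop}
    (hP : ∀ (w : U × Fin (d + 1) → ℝ) (D : Finset U) (y : U × Fin (d + 1) → ℂ),
      (∀ a, w a = blockMin D a.1 ∨ w a = blockMin D a.1 + 1) →
      (∀ u ∈ D, ∃ j, w (u, j) = -1) → (∀ a, y a ≠ 0) → (∀ k, eval y (initialForm w (F k)) = 0) →
      ∀ u, ∃ j, P j ∧ w (u, j) = blockMin D u)
    (hF : ∀ x : U × Fin (d + 1) → ℂ, (∀ k, eval x (F k) = 0) → ∀ a, x a ≠ 0)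
    (h : HasToricFaceRoot F) : ∃ L : U → Fin (d + 1), (∀ u, P (L u)) ∧ HasZeroDeltaRoot L F := by
  obtain ⟨w, hw, y, hy, hroot⟩ := h
  obtain ⟨D, hD, hblock⟩ := hw.exists_blocks
  choose L hLP hL using hP w D y hblock hD hy hroot
  have hmin : ∀ a, blockMin D a.1 ≤ w a := fun a => by
    rcases hblock a with h | h <;> rw [h]
    exact le_add_of_nonneg_right zero_le_one
  set x : U × Fin (d + 1) → ℂ := fun a => if w a = blockMin D a.1 then y a else 0 with hx
  set z : U → ℂ := fun u => if u ∈ D then 0 else 1 with hz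
  have hzero : ∀ k, homEval (blockDegree (F k)) (F k) z x = 0 := fun k =>
    homEval_face_eq_zero hmin (blockLE_blockDegree (F k)) (hroot k)
  have hxL : ∀ u, x (u, L u) ≠ 0 := fun u => by
    rw [hx]
    simp only [hL u, if_true]
    exact hy _
  -- With `D` empty all `z u` are `1`, so `x` solves the original system and vanishes wherever `w ≠
  -- 0`, contrary to `hF`.
  have hDne : D.Nonempty := by
    by_contra hne
    rw [Finset.not_nonempty_iff_eq_empty] at hne
    subst hne
    obtain ⟨a, ha⟩ := Function.ne_iff.1 hw.1
    refine hF x (fun k => ?_) a ?_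
    · rw [← homEval_one (blockDegree (F k))]
      simpa [hz] using hzero k
    · rw [hx]
      refine if_neg fun h => ha ?_
      rw [h]
      simp [blockMin]
  obtain ⟨u₀, hu₀⟩ := hDne
  -- Block `u` is divided by `x (u, L u)`; the slot `(u, L u)` then stores the rescaled homogenizing
  -- variable.
  refine ⟨L, hLP, fun a => if a.2 = L a.1 then (x (a.1, L a.1))⁻¹ * z a.1
    else (x (a.1, L a.1))⁻¹ * x a, fun k => ?_, u₀, ?_⟩
  · rw [eval_transform]
    have h1 := homEval_smul (blockLE_blockDegree (F k)) (fun u => (x (u, L u))⁻¹) z x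
    rw [hzero k, mul_zero] at h1
    rw [← h1]
    congr 1
    · funext u
      simp
    · funext a
      split_ifs with h
      · rw [← h, inv_mul_cancel₀]
        have := hxL a.1
        rwa [← h] at this
      · rfl
  · simp [hz, hu₀]

/-- A solution of a transformed system at infinity gives a root of the multihomogenized system in
which the homogenizing variables are `0` or `1`. -/
theorem HasZeroDeltaRoot.exists_homEval {κ : Type*}
    {F : κ → MvPolynomial (U × Fin (d + 1)) ℂ}
    {L : U → Fin (d + 1)} (h : HasZeroDeltaRoot L F) : ∃ D : Finset U, D.Nonempty ∧
      ∃ x : U × Fin (d + 1) → ℂ, (∀ u, x (u, L u) ≠ 0) ∧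
        ∀ k, homEval (blockDegree (F k)) (F k) (fun u => if u ∈ D then 0 else 1) x = 0 := by
  classical
  obtain ⟨t, ht, u₀, hu₀⟩ := h
  have hc : ∀ u, (if t (u, L u) = 0 then 1 else (t (u, L u))⁻¹) ≠ 0 := fun u => by
    split_ifs with h
    exacts [one_ne_zero, inv_ne_zero h]
  -- A block with nonzero homogenizing variable is rescaled to make it `1`; the others are left
  -- alone.
  refine ⟨Finset.univ.filter fun u => t (u, L u) = 0, ⟨u₀, by simpa using hu₀⟩,
    fun a => (if t (a.1, L a.1) = 0 then 1 else (t (a.1, L a.1))⁻¹) *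
      (if a.2 = L a.1 then 1 else t a), fun u => ?_, fun k => ?_⟩
  · simpa using hc u
  · have h1 := homEval_smul (blockLE_blockDegree (F k))
      (fun u => if t (u, L u) = 0 then 1 else (t (u, L u))⁻¹) (fun u => t (u, L u))
      (fun a => if a.2 = L a.1 then 1 else t a)
    rw [← eval_transform, ht k, mul_zero] at h1
    refine Eq.trans ?_ h1
    congr 1
    funext u
    by_cases h : t (u, L u) = 0 <;> simp [h]

/-- A root of the multihomogenized system at infinity without vanishing coordinates gives a toric
root of a face system. -/
theorem hasToricFaceRoot_of_homEval {κ : Type*} {F : κ → MvPolynomial (U × Fin (d + 1)) ℂ}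
    {D : Finset U} (hD : D.Nonempty) {b : κ → U → ℕ} (hF : ∀ k, BlockLE (b k) (F k))
    (hb : ∀ k, ∃ β ∈ (F k).support, ∀ u, ∑ j, β (u, j) = b k u) {y : U × Fin (d + 1) → ℂ}
    (hy : ∀ a, y a ≠ 0) (h : ∀ k, homEval (b k) (F k) (fun u => if u ∈ D then 0 else 1) y = 0) :
    HasToricFaceRoot F :=
  ⟨_, isFaceNormal_blockMin hD, y, hy, fun k => by
    rw [eval_initialForm_delta D (hF k) (hb k), h k]⟩

end Faces

/-! ### Counting edges -/

section Count

variable {V : Type*} [Fintype V]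

/-- The rigidity matrix of a framework, as a linear map. -/
def rigidityMap (G : SimpleGraph V) (d : ℕ) (p : V → Fin d → ℝ) :
    (V → Fin d → ℝ) →ₗ[ℝ] (G.edgeSet → ℝ) where
  toFun q e := ∑ i, (p (Quot.out e.1).1 i - p (Quot.out e.1).2 i) *
    (q (Quot.out e.1).1 i - q (Quot.out e.1).2 i)
  map_add' q q' := by
    funext e
    refine Eq.trans ?_ Finset.sum_add_distrib
    exact Finset.sum_congr rfl fun i _ => by simp only [Pi.add_apply]; ring
  map_smul' c q := by
    funext e
    refine Eq.trans ?_ (Finset.smul_sum (r := c)).symm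
    exact Finset.sum_congr rfl fun i _ => by
      simp only [Pi.smul_apply, smul_eq_mul]; ring

omit [Fintype V] in
-- The endpoints chosen by `Quot.out` may come in either order, but the row of an edge is symmetric
-- in them.
theorem ker_rigidityMap_le (G : SimpleGraph V) (d : ℕ) (p : V → Fin d → ℝ) :
    LinearMap.ker (rigidityMap G d p) ≤ infMotions G d p := by
  intro q hq u v huv
  have h := congrFun (LinearMap.mem_ker.1 hq) ⟨s(u, v), huv⟩
  change ∑ i, (p (Quot.out s(u, v)).1 i - p (Quot.out s(u, v)).2 i) *
    (q (Quot.out s(u, v)).1 i - q (Quot.out s(u, v)).2 i) = 0 at h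
  have hout : s((Quot.out s(u, v)).1, (Quot.out s(u, v)).2) = s(u, v) := Quot.out_eq s(u, v)
  rcases Sym2.eq_iff.1 hout with ⟨h1, h2⟩ | ⟨h1, h2⟩
  · rwa [h1, h2] at h
  · rw [h1, h2] at h
    rw [← h]
    exact Finset.sum_congr rfl fun i _ => by ring

/-- A rigid graph has at least `d |V| - d (d + 1) / 2` edges. -/
theorem IsRigid.le_card_edgeSet {G : SimpleGraph V} {d : ℕ} (h : IsRigid G d) :
    Fintype.card V * d ≤ Nat.card G.edgeSet + (d + 1).choose 2 := by
  obtain ⟨p, hp⟩ := h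
  have := Fintype.ofFinite G.edgeSet
  -- Rank-nullity: the rank is at most the number of edges, and the nullity is at most `(d +
  -- 1).choose 2`.
  have h1 := LinearMap.finrank_range_add_finrank_ker (rigidityMap G d p)
  have h2 := Submodule.finrank_mono (ker_rigidityMap_le G d p)
  have h3 := Submodule.finrank_le (LinearMap.range (rigidityMap G d p))
  rw [Module.finrank_fintype_fun_eq_card] at h3
  rw [Module.finrank_pi_fintype] at h1
  simp only [Module.finrank_fintype_fun_eq_card, Fintype.card_fin, Finset.sum_const,
    Finset.card_univ, smul_eq_mul] at h1
  rw [Nat.card_eq_fintype_card]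
  omega

/-- An edge is either free or a non-diagonal pair of fixed vertices. -/
theorem card_edgeSet_le [DecidableEq V] (G : SimpleGraph V) (K : Finset V) :
    Nat.card G.edgeSet ≤ Nat.card (FreeEdge G K) + K.card.choose 2 := by
  let g : FreeEdge G K ⊕ {a : Sym2 K // ¬ a.IsDiag} → Sym2 V :=
    Sum.elim Subtype.val fun a => a.1.map Subtype.val
  have hsub : G.edgeSet ⊆ Set.range g := by
    intro e he
    by_cases h : ∀ v ∈ e, v ∈ K
    · induction e with | _ u v
      refine ⟨Sum.inr ⟨s(⟨u, h u (Sym2.mem_mk_left u v)⟩, ⟨v, h v (Sym2.mem_mk_right u v)⟩),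
        fun hd => G.ne_of_adj he ?_⟩, rfl⟩
      exact congrArg Subtype.val hd
    · exact ⟨Sum.inl ⟨e, he, h⟩, rfl⟩
  have h1 : Nat.card G.edgeSet ≤ Nat.card (Set.range g) := Nat.card_mono (Set.toFinite _) hsub
  have h2 : Nat.card (Set.range g) ≤ Nat.card (FreeEdge G K ⊕ {a : Sym2 K // ¬ a.IsDiag}) :=
    Nat.card_le_card_of_surjective _ Set.rangeFactorization_surjective
  rw [Nat.card_sum, Nat.card_eq_fintype_card (α := {a : Sym2 K // ¬ a.IsDiag}),
    Sym2.card_subtype_not_diag, Fintype.card_coe] at h2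
  omega

/-- There are at least `d` free edges for each free vertex. -/
theorem IsRigid.le_card_freeEdge [DecidableEq V] {G : SimpleGraph V} {d : ℕ} (h : IsRigid G d)
    {K : Finset V} (hK : K.card = d) : Nat.card (Free K) * d ≤ Nat.card (FreeEdge G K) := by
  have h1 := h.le_card_edgeSet
  have h2 := card_edgeSet_le G K
  have h3 : Fintype.card V = Nat.card (Free K) + d := by
    rw [Nat.card_eq_fintype_card, Fintype.card_subtype_compl, Fintype.card_coe, hK,
      Nat.sub_add_cancel (hK ▸ K.card_le_univ)]
  -- The trivial motions and the edges inside `K` together account for the `d * d` coordinates of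
  -- the fixed vertices.
  have h4 : (d + 1).choose 2 + d.choose 2 = d * d := by
    clear * -
    induction d with
    | zero => rfl
    | succ n ih =>
      have e1 : (n + 2).choose 2 = (n + 1) + (n + 1).choose 2 := by
        rw [Nat.choose_succ_succ' (n + 1) 1, Nat.choose_one_right]
      have e2 : (n + 1).choose 2 = n + n.choose 2 := by
        rw [Nat.choose_succ_succ' n 1, Nat.choose_one_right]
      nlinarith
  rw [hK] at h2
  rw [h3, add_mul] at h1
  omega

end Count

/-! ### Reflections -/

section Reflection

variable {n : ℕ}

/-- The reflection along `a`, multiplied by `⟨a, a⟩`. -/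
def refl {R : Type*} [CommRing R] (a x : Fin n → R) : Fin n → R :=
  fun j => a ⬝ᵥ a * x j - 2 * (a ⬝ᵥ x) * a j

theorem refl_eq {R : Type*} [CommRing R] (a x : Fin n → R) :
    refl a x = (a ⬝ᵥ a) • x - (2 * (a ⬝ᵥ x)) • a := rfl

/-- Clearing the denominator `⟨a, a⟩` turns the isometry into a similarity that is polynomial in
`a`, so generic choices of `a` make sense. -/
theorem refl_dotProduct_refl {R : Type*} [CommRing R] (a x y : Fin n → R) :
    refl a x ⬝ᵥ refl a y = (a ⬝ᵥ a) ^ 2 * (x ⬝ᵥ y) := by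
  simp only [refl_eq, sub_dotProduct, dotProduct_sub, smul_dotProduct, dotProduct_smul,
    smul_eq_mul, dotProduct_comm x a]
  ring

theorem refl_refl {R : Type*} [CommRing R] (a x : Fin n → R) :
    refl a (refl a x) = (a ⬝ᵥ a) ^ 2 • x := by
  funext j
  simp only [refl_eq, dotProduct_sub, dotProduct_smul, Pi.sub_apply, Pi.smul_apply, smul_eq_mul]
  ring

theorem map_refl {R R' : Type*} [CommRing R] [CommRing R'] (φ : R →+* R') (a x : Fin n → R)
    (j : Fin n) : φ (refl a x j) = refl (fun i => φ (a i)) (fun i => φ (x i)) j := by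
  simp only [refl, dotProduct, map_sub, map_mul, map_sum, map_ofNat]

/-- Generic reflections move every nonzero vector away from the coordinate hyperplanes. -/
theorem exists_refl_ne_zero {x : Fin n → ℂ} (hx : x ≠ 0) (j : Fin n) : ∃ a, refl a x j ≠ 0 := by
  by_cases hj : x j = 0
  · obtain ⟨k, hk⟩ := Function.ne_iff.1 hx
    have hjk : j ≠ k := fun h => hk (h ▸ hj)
    -- Here `⟨a, x⟩ = x k`, so the reflected `j`-th coordinate is `-2 * x k`.
    refine ⟨Pi.single j 1 + Pi.single k 1, ?_⟩
    simpa [refl, hj, add_dotProduct, Pi.single_apply, hjk] using hk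
  · refine ⟨Pi.single j 1, ?_⟩
    simp only [refl, single_dotProduct, Pi.single_eq_same, one_mul, mul_one]
    intro h
    exact hj (by linear_combination -h)

/-- A generic reflection moves finitely many nonzero vectors away from the coordinate hyperplanes,
and may be chosen outside of a given hypersurface. -/
theorem exists_refl_generic {ι : Type*} [Finite ι] (x : ι → Fin n → ℂ) (hx : ∀ i, x i ≠ 0)
    (N : MvPolynomial (Fin n) ℂ) {a₀ : Fin n → ℂ} (hN : eval a₀ N ≠ 0) :
    ∃ a : Fin n → ℂ, (∀ i j, refl a (x i) j ≠ 0) ∧ eval a N ≠ 0 := by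
  obtain ⟨a, ha⟩ := exists_common_eval_ne_zero
    (fun o : Option (ι × Fin n) => o.elim N fun p => refl X (fun i => C (x p.1 i)) p.2) (by
      rintro (_ | ⟨i, j⟩)
      · exact ⟨a₀, hN⟩
      · obtain ⟨a, ha⟩ := exists_refl_ne_zero (hx i) j
        refine ⟨a, ?_⟩
        simpa [map_refl] using ha)
  refine ⟨a, fun i j => ?_, ha none⟩
  simpa [map_refl] using ha (some (i, j))

end Reflection

/-! ### The edge equations in homogeneous coordinates -/

section EdgeForm

variable {V : Type*} {R : Type*} [CommRing R] {n : ℕ}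

/-- The homogenized edge equation. -/
def edgeForm (Z : V → R) (X : V → Fin n → R) (S : V → R) (l : R) (e : Sym2 V) : R :=
  Sym2.lift ⟨fun u v => S u * Z v + S v * Z u - 2 * (X u ⬝ᵥ X v) - l * (Z u * Z v), fun u v => by
    simp only [dotProduct_comm (X u) (X v)]; ring⟩ e

@[simp]
theorem edgeForm_mk (Z : V → R) (X : V → Fin n → R) (S : V → R) (l : R) (u v : V) :
    edgeForm Z X S l s(u, v) = S u * Z v + S v * Z u - 2 * (X u ⬝ᵥ X v) - l * (Z u * Z v) := rfl

theorem map_edgeForm {R' : Type*} [CommRing R'] (φ : R →+* R') (Z : V → R) (X : V → Fin n → R)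
    (S : V → R) (l : R) (e : Sym2 V) : φ (edgeForm Z X S l e) =
      edgeForm (fun v => φ (Z v)) (fun v i => φ (X v i)) (fun v => φ (S v)) (φ l) e := by
  induction e with | _ u v
  simp only [edgeForm_mk, map_sub, map_add, map_mul, map_ofNat, dotProduct, map_sum]

theorem edgeForm_refl (a : Fin n → R) (Z : V → R) (X : V → Fin n → R) (S : V → R) (l : R)
    (e : Sym2 V) : edgeForm Z (fun v => refl a (X v)) (fun v => (a ⬝ᵥ a) ^ 2 * S v)
      ((a ⬝ᵥ a) ^ 2 * l) e = (a ⬝ᵥ a) ^ 2 * edgeForm Z X S l e := by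
  induction e with | _ u v
  simp only [edgeForm_mk, refl_dotProduct_refl]
  ring

/-- The new `S` homogenizes `‖x + τ‖² = ‖x‖² + 2⟨x, τ⟩ + ‖τ‖²`, and an edge equation depends only on
a difference of positions. The identity survives at `Z v = 0`. -/
theorem edgeForm_translate (τ : Fin n → R) (Z : V → R) (X : V → Fin n → R) (S : V → R) (l : R)
    (e : Sym2 V) : edgeForm Z (fun v => X v + Z v • τ)
      (fun v => S v + 2 * (X v ⬝ᵥ τ) + Z v * (τ ⬝ᵥ τ)) l e = edgeForm Z X S l e := by
  induction e with | _ u v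
  simp only [edgeForm_mk, add_dotProduct, dotProduct_add, smul_dotProduct, dotProduct_smul,
    smul_eq_mul, dotProduct_comm τ]
  ring

/-- The product of the values of a function at the endpoints of an edge. -/
def endProd (c : V → R) (e : Sym2 V) : R := Sym2.lift ⟨fun u v => c u * c v, fun _ _ => mul_comm _ _⟩ e

@[simp]
theorem endProd_mk (c : V → R) (u v : V) : endProd c s(u, v) = c u * c v := rfl

theorem edgeForm_smul (c Z : V → R) (X : V → Fin n → R) (S : V → R) (l : R) (e : Sym2 V) :
    edgeForm (fun v => c v * Z v) (fun v => c v • X v) (fun v => c v * S v) l e =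
      endProd c e * edgeForm Z X S l e := by
  induction e with | _ u v
  simp only [edgeForm_mk, endProd_mk, smul_dotProduct, dotProduct_smul, smul_eq_mul]
  ring

end EdgeForm

/-! ### Fixed and free vertices; multidegrees of the edge equations -/

section Glue

variable {V : Type*} [DecidableEq V] {K : Finset V}

/-- The function on all vertices with given values at the fixed and at the free vertices. -/
def glue {α : Type*} (c : {v : V // v ∈ K} → α) (x : Free K → α) (v : V) : α :=
  if h : v ∈ K then c ⟨v, h⟩ else x ⟨v, h⟩

theorem glue_of_mem {α : Type*} (c : {v : V // v ∈ K} → α) (x : Free K → α) {v : V} (h : v ∈ K) :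
    glue c x v = c ⟨v, h⟩ := dif_pos h

theorem glue_of_notMem {α : Type*} (c : {v : V // v ∈ K} → α) (x : Free K → α) {v : V}
    (h : v ∉ K) : glue c x v = x ⟨v, h⟩ := dif_neg h

theorem map_glue {α β : Type*} (f : α → β) (c : {v : V // v ∈ K} → α) (x : Free K → α) (v : V) :
    f (glue c x v) = glue (fun v => f (c v)) (fun u => f (x u)) v :=
  apply_dite f _ _ _

/-- Fixed endpoints contribute the factor `1`; distinct endpoints ensure that no exponent should be
`2`. -/
theorem prod_mem_edge [Fintype V] (z : Free K → ℂ) {u v : V} (huv : u ≠ v) :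
    ∏ w : Free K, z w ^ (if w.1 ∈ s(u, v) then 1 else 0) =
      endProd (glue (fun _ => 1) z) s(u, v) := by
  have key : ∀ u : V, ∏ w : Free K, (if w.1 = u then z w else 1) = glue (fun _ => 1) z u := by
    intro u
    by_cases h : u ∈ K
    · rw [glue_of_mem _ _ h]
      exact Finset.prod_eq_one fun w _ => if_neg fun hw => w.2 (by rw [hw]; exact h)
    · rw [glue_of_notMem _ _ h, Finset.prod_eq_single ⟨u, h⟩]
      · simp
      · exact fun w _ hw => if_neg fun h' => hw (Subtype.ext h')
      · simp
  rw [endProd_mk, ← key u, ← key v, ← Finset.prod_mul_distrib]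
  refine Finset.prod_congr rfl fun w _ => ?_
  by_cases h1 : w.1 = u
  · have h2 : w.1 ≠ v := h1 ▸ huv
    simp [h1, h1 ▸ h2]
  · by_cases h2 : w.1 = v <;> simp [h1, h2, huv.symm]

/-- The block degree of a vertex coordinate. -/
def vertexDeg (u : V) (w : Free K) : ℕ := if w.1 = u then 1 else 0

/-- The block degree of an edge equation. -/
def edgeDeg (e : Sym2 V) (w : Free K) : ℕ := if w.1 ∈ e then 1 else 0

variable [Fintype V] {d : ℕ}

omit [Fintype V] in
theorem blockLE_var (u : Free K) (i : Fin (d + 1)) :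
    BlockLE (vertexDeg u.1) (X (u, i) : MvPolynomial (Var K d) ℂ) := by
  refine (blockLE_X (u, i)).mono fun w => ?_
  by_cases h : w = u
  · subst h; simp [vertexDeg]
  · simp [h]

omit [Fintype V] in
theorem blockLE_edgePoly {n : ℕ} {X : V → Fin n → MvPolynomial (Var K d) ℂ}
    {s : V → MvPolynomial (Var K d) ℂ} (hX : ∀ v i, BlockLE (vertexDeg v) (X v i))
    (hs : ∀ v, BlockLE (vertexDeg v) (s v)) (l : ℝ) {e : Sym2 V} (he : ¬ e.IsDiag) :
    BlockLE (edgeDeg e) (edgePoly X s l e) := by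
  induction e with | _ u v
  rw [Sym2.mk_isDiag_iff] at he
  have hu : (vertexDeg u : Free K → ℕ) ≤ edgeDeg s(u, v) := fun w => by
    unfold vertexDeg edgeDeg
    split_ifs with h1 h2 <;> simp_all
  have hv : (vertexDeg v : Free K → ℕ) ≤ edgeDeg s(u, v) := fun w => by
    unfold vertexDeg edgeDeg
    split_ifs with h1 h2 <;> simp_all
  have huv : (vertexDeg u + vertexDeg v : Free K → ℕ) ≤ edgeDeg s(u, v) := fun w => by
    simp only [vertexDeg, edgeDeg, Pi.add_apply]
    split_ifs with h1 h2 <;> simp_all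
  refine BlockLE.sub (BlockLE.sub (((hs u).mono hu).add ((hs v).mono hv)) ?_) (blockLE_C _ _)
  have h2 : (2 : MvPolynomial (Var K d) ℂ) = C 2 := (map_ofNat C 2).symm
  rw [h2, ← zero_add (edgeDeg s(u, v))]
  exact (blockLE_C _ _).mul (BlockLE.sum fun i _ => ((hX u i).mul (hX v i)).mono huv)

omit [Fintype V] in
theorem continuous_edgeForm {n : ℕ} (X : V → Fin n → ℂ) (S : V → ℂ) (l : ℂ) (e : Sym2 V) :
    Continuous fun z : Free K → ℂ => edgeForm (glue (fun _ => 1) z) X S l e := by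
  have h : ∀ v : V, Continuous fun z : Free K → ℂ => glue (fun _ => 1) z v := fun v => by
    by_cases hv : v ∈ K
    · simp only [glue_of_mem _ _ hv]
      exact continuous_const
    · simp only [glue_of_notMem _ _ hv]
      exact continuous_apply _
  induction e with | _ u v
  simp only [edgeForm_mk]
  have hu := h u
  have hv := h v
  fun_prop

/-- The multihomogenization of an edge equation is an edge form. -/
theorem homEval_edge {n : ℕ} {f : MvPolynomial (Var K d) ℂ} {e : Sym2 V} (he : ¬ e.IsDiag)
    (hf : BlockLE (edgeDeg e) f) {x : Var K d → ℂ} {X : V → Fin n → ℂ} {S : V → ℂ} {l : ℂ}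
    (h : ∀ z : Free K → ℂ, (∀ u, z u ≠ 0) → eval (fun a => (z a.1)⁻¹ * x a) f =
      edgeForm (fun _ => 1) (fun v => (glue (fun _ => 1) z v)⁻¹ • X v)
        (fun v => (glue (fun _ => 1) z v)⁻¹ * S v) l e) (z : Free K → ℂ) :
    homEval (edgeDeg e) f z x = edgeForm (glue (fun _ => 1) z) X S l e := by
  refine homEval_eq hf (continuous_edgeForm X S l e) (fun z hz => ?_) z
  have hZ : ∀ v, glue (fun _ => 1) z v ≠ 0 := fun v => by
    unfold glue
    split_ifs
    exacts [one_ne_zero, hz _]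
  have hp : ∏ u, z u ^ edgeDeg e u = endProd (glue (fun _ => 1) z) e := by
    induction e with | _ u v
    exact prod_mem_edge z (by simpa using he)
  rw [h z hz, hp, ← edgeForm_smul]
  simp only [mul_one, smul_smul, mul_inv_cancel₀ (hZ _), one_smul, mul_inv_cancel_left₀ (hZ _)]

end Glue

theorem eval_bind₁_eq {σ τ : Type*} (f : σ → MvPolynomial τ ℂ) (Φ : MvPolynomial σ ℂ) (x : τ → ℂ) :
    eval x (bind₁ f Φ) = eval (fun s => eval x (f s)) Φ := by
  exact eval₂Hom_bind₁ (RingHom.id ℂ) x f Φ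

/-! ### Initial forms of the magnitude equations -/

section Magnitude

variable {σ : Type*} [Fintype σ]

theorem weight_single (w : σ → ℝ) (a : σ) (c : ℕ) : weight w (Finsupp.single a c) = c * w a := by
  rw [weight, Finset.sum_eq_single a]
  · simp
  · intro b _ hb
    simp [Finsupp.single_eq_of_ne hb]
  · simp

/-- The initial form of a magnitude equation has no torus root if the weights of all squares exceed
the weight of the remaining term. -/
theorem magnitude_initialForm_ne_zero {U : Type*} [Fintype U] {d n : ℕ}
    (a : Fin n → U × Fin (d + 1)) (β : U × Fin (d + 1) →₀ ℕ) {w : U × Fin (d + 1) → ℝ}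
    (hw : ∀ i, weight w β < 2 * w (a i)) {y : U × Fin (d + 1) → ℂ} (hy : ∀ a, y a ≠ 0) :
    eval y (initialForm w (∑ i, X (a i) ^ 2 - monomial β 1)) ≠ 0 := by
  classical
  have hne : ∀ i, Finsupp.single (a i) 2 ≠ β := fun i h => by
    have := hw i
    rw [← h, weight_single] at this
    norm_num at this
  have hco : ∀ γ, coeff γ (∑ i, X (a i) ^ 2 - monomial β 1 : MvPolynomial (U × Fin (d + 1)) ℂ)
      = ∑ i, (if Finsupp.single (a i) 2 = γ then 1 else 0) - if β = γ then 1 else 0 := fun γ => by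
    rw [coeff_sub, coeff_sum, coeff_monomial]
    simp only [coeff_X_pow]
  refine eval_initialForm_ne_zero (β := β) ?_ (fun γ hγ hγβ => ?_) hy
  · rw [mem_support_iff, hco]
    simp [hne]
  · rw [mem_support_iff, hco, if_neg hγβ.symm, sub_zero] at hγ
    obtain ⟨i, -, hi⟩ := Finset.exists_ne_zero_of_sum_ne_zero hγ
    have : Finsupp.single (a i) 2 = γ := by
      by_contra h
      exact hi (if_neg h)
    rw [← this, weight_single]
    exact_mod_cast hw i

end Magnitude

/-! ### The sphere equations in Euclidean space -/

section Euclid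

variable {V : Type*} [DecidableEq V] {G : SimpleGraph V} {K : Finset V} {d : ℕ}

section Defs

variable {R : Type*} [CommRing R]

/-- The coordinates of all vertices. -/
def euclX (ϑ : Param G K d → R) (x : Var K d → R) : V → Fin d → R :=
  glue (fun v i => ϑ (Sum.inl (v, i))) fun u i => x (u, i.castSucc)

/-- The squared magnitudes of all vertices. -/
def euclS (ϑ : Param G K d → R) (x : Var K d → R) : V → R :=
  glue (fun v => ∑ i, ϑ (Sum.inl (v, i)) ^ 2) fun u => x (u, Fin.last d)

/-- The homogenized sphere equations; the parameter of an edge is its squared length. -/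
def euclHom (ϑ : Param G K d → R) (z : Free K → R) (x : Var K d → R) : Free K ⊕ FreeEdge G K → R
  | Sum.inl u => ∑ i : Fin d, x (u, i.castSucc) ^ 2 - x (u, Fin.last d) * z u
  | Sum.inr e => edgeForm (glue (fun _ => 1) z) (euclX ϑ x) (euclS ϑ x) (ϑ (Sum.inr e)) e

theorem map_euclHom {R' : Type*} [CommRing R'] (φ : R →+* R') (ϑ : Param G K d → R)
    (z : Free K → R) (x : Var K d → R) (k : Free K ⊕ FreeEdge G K) : φ (euclHom ϑ z x k) =
      euclHom (fun a => φ (ϑ a)) (fun u => φ (z u)) (fun a => φ (x a)) k := by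
  rcases k with u | e
  · simp only [euclHom, map_sub, map_sum, map_pow, map_mul]
  · simp only [euclHom, map_edgeForm]
    congr 1
    · funext v
      rw [map_glue φ]
      simp
    · funext v i
      unfold euclX glue
      split_ifs <;> rfl
    · funext v
      rw [euclS, map_glue φ]
      simp [euclS]

/-- The action of a reflection on the parameters. -/
def euclReflParam (a : Fin d → R) (ϑ : Param G K d → R) : Param G K d → R
  | Sum.inl (v, i) => refl a (fun j => ϑ (Sum.inl (v, j))) i
  | Sum.inr e => (a ⬝ᵥ a) ^ 2 * ϑ (Sum.inr e)

/-- The action of a reflection on the variables. -/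
def euclReflVar (a : Fin d → R) (x : Var K d → R) : Var K d → R :=
  fun b => Fin.snoc (α := fun _ => R) (refl a fun i => x (b.1, i.castSucc))
    ((a ⬝ᵥ a) ^ 2 * x (b.1, Fin.last d)) b.2

omit [DecidableEq V] in
@[simp]
theorem euclReflVar_castSucc (a : Fin d → R) (x : Var K d → R) (u : Free K) (i : Fin d) :
    euclReflVar a x (u, i.castSucc) = refl a (fun i => x (u, i.castSucc)) i :=
  Fin.snoc_castSucc _ _ _

omit [DecidableEq V] in
@[simp]
theorem euclReflVar_last (a : Fin d → R) (x : Var K d → R) (u : Free K) :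
    euclReflVar a x (u, Fin.last d) = (a ⬝ᵥ a) ^ 2 * x (u, Fin.last d) :=
  Fin.snoc_last _ _

theorem sum_sq_eq_dotProduct {n : ℕ} (x : Fin n → R) : ∑ i, x i ^ 2 = x ⬝ᵥ x :=
  Finset.sum_congr rfl fun i _ => pow_two (x i)

theorem euclHom_refl (a : Fin d → R) (ϑ : Param G K d → R) (z : Free K → R) (x : Var K d → R)
    (k : Free K ⊕ FreeEdge G K) : euclHom (euclReflParam a ϑ) z (euclReflVar a x) k =
      (a ⬝ᵥ a) ^ 2 * euclHom ϑ z x k := by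
  rcases k with u | e
  · simp only [euclHom, euclReflVar_castSucc, euclReflVar_last, sum_sq_eq_dotProduct,
      refl_dotProduct_refl]
    ring
  · have hX : euclX (euclReflParam a ϑ) (euclReflVar a x) = fun v => refl a (euclX ϑ x v) := by
      funext v
      rw [euclX, euclX, map_glue (refl a)]
      congr 1
      funext u i
      simp
    have hS : euclS (euclReflParam a ϑ) (euclReflVar a x) =
        fun v => (a ⬝ᵥ a) ^ 2 * euclS ϑ x v := by
      funext v
      rw [euclS, euclS, map_glue fun s => (a ⬝ᵥ a) ^ 2 * s]
      simp only [euclReflParam, sum_sq_eq_dotProduct, refl_dotProduct_refl, euclReflVar_last]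
    simp only [euclHom]
    rw [hX, hS, ← edgeForm_refl]
    rfl

/-- The action of a translation on the parameters. -/
def euclTransParam (τ : Fin d → R) (ϑ : Param G K d → R) : Param G K d → R
  | Sum.inl (v, i) => ϑ (Sum.inl (v, i)) + τ i
  | Sum.inr e => ϑ (Sum.inr e)

/-- The action of a translation on the variables. -/
def euclTransVar (τ : Fin d → R) (z : Free K → R) (x : Var K d → R) : Var K d → R :=
  fun b => Fin.snoc (α := fun _ => R) (fun i => x (b.1, i.castSucc) + z b.1 * τ i)
    (x (b.1, Fin.last d) + 2 * ((fun i => x (b.1, i.castSucc)) ⬝ᵥ τ) + z b.1 * (τ ⬝ᵥ τ)) b.2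

omit [DecidableEq V] in
@[simp]
theorem euclTransVar_castSucc (τ : Fin d → R) (z : Free K → R) (x : Var K d → R) (u : Free K)
    (i : Fin d) : euclTransVar τ z x (u, i.castSucc) = x (u, i.castSucc) + z u * τ i :=
  Fin.snoc_castSucc _ _ _

omit [DecidableEq V] in
@[simp]
theorem euclTransVar_last (τ : Fin d → R) (z : Free K → R) (x : Var K d → R) (u : Free K) :
    euclTransVar τ z x (u, Fin.last d) =
      x (u, Fin.last d) + 2 * ((fun i => x (u, i.castSucc)) ⬝ᵥ τ) + z u * (τ ⬝ᵥ τ) :=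
  Fin.snoc_last _ _

omit [DecidableEq V] in
theorem map_euclTransVar {R' : Type*} [CommRing R'] (φ : R →+* R') (τ : Fin d → R)
    (z : Free K → R) (x : Var K d → R) (a : Var K d) : φ (euclTransVar τ z x a) =
      euclTransVar (fun i => φ (τ i)) (fun u => φ (z u)) (fun a => φ (x a)) a := by
  obtain ⟨u, j⟩ := a
  induction j using Fin.lastCases with
  | last => simp only [euclTransVar_last, dotProduct, map_add, map_mul, map_sum, map_ofNat]
  | cast i => simp

/-- At `z u = 0` a translation fixes the coordinates of `u` and adds `2⟨x_u, τ⟩` to `s_u`, which is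
how a vanishing `s_u` is repaired at infinity. -/
theorem euclHom_trans (τ : Fin d → R) (ϑ : Param G K d → R) (z : Free K → R) (x : Var K d → R)
    (k : Free K ⊕ FreeEdge G K) : euclHom (euclTransParam τ ϑ) z (euclTransVar τ z x) k =
      euclHom ϑ z x k := by
  rcases k with u | e
  · have h : (fun i : Fin d => x (u, i.castSucc) + z u * τ i) =
      (fun i => x (u, i.castSucc)) + z u • τ := rfl
    simp only [euclHom, euclTransVar_castSucc, euclTransVar_last, sum_sq_eq_dotProduct, h,
      add_dotProduct, dotProduct_add, smul_dotProduct, dotProduct_smul, smul_eq_mul,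
      dotProduct_comm τ]
    ring
  · have hX : euclX (euclTransParam τ ϑ) (euclTransVar τ z x) =
        fun v => euclX ϑ x v + glue (fun _ => 1) z v • τ := by
      funext v i
      by_cases h : v ∈ K
      · simp [euclX, glue_of_mem _ _ h, euclTransParam]
      · simp [euclX, glue_of_notMem _ _ h]
    have hS : euclS (euclTransParam τ ϑ) (euclTransVar τ z x) =
        fun v => euclS ϑ x v + 2 * (euclX ϑ x v ⬝ᵥ τ) + glue (fun _ => 1) z v * (τ ⬝ᵥ τ) := by
      funext v
      by_cases h : v ∈ K
      · simp only [euclX, euclS, glue_of_mem _ _ h, euclTransParam, dotProduct, Finset.mul_sum,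
          ← Finset.sum_add_distrib]
        exact Finset.sum_congr rfl fun i _ => by ring
      · simp [euclX, euclS, glue_of_notMem _ _ h]
    simp only [euclHom]
    rw [hX, hS, edgeForm_translate]
    rfl

end Defs

/-- The complex parameters of a Euclidean system: the fixed points and the squared lengths. -/
def euclCplx (θ : Param G K d → ℝ) : Param G K d → ℂ
  | Sum.inl a => (θ (Sum.inl a) : ℂ)
  | Sum.inr e => (θ (Sum.inr e) : ℂ) ^ 2

theorem eval_euclSystem (θ : Param G K d → ℝ) (x : Var K d → ℂ) (k : Free K ⊕ FreeEdge G K) :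
    eval x (euclSystem θ k) = euclHom (euclCplx θ) (fun _ => 1) x k := by
  have hX : ∀ v i, eval x (euclCoord θ v i) = euclX (euclCplx θ) x v i := fun v i => by
    unfold euclCoord euclX glue
    split_ifs
    · simp [euclCplx]
    · simp
  have hS : ∀ v, eval x (euclSq θ v) = euclS (euclCplx θ) x v := fun v => by
    unfold euclSq euclS glue
    split_ifs
    · simp [euclCplx]
    · simp
  rcases k with u | e
  · simp only [euclSystem, euclHom, map_sub, map_sum, map_pow, hX, hS, euclX, euclS,
      glue_of_notMem _ _ u.2, mul_one]
  · obtain ⟨e, he⟩ := e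
    simp only [euclSystem, euclHom]
    induction e with | _ u v
    have h1 : ∀ v, glue (K := K) (fun _ => (1 : ℂ)) (fun _ => 1) v = 1 := fun v => by
      unfold glue; split_ifs <;> rfl
    simp [edgePoly, hX, hS, h1, euclCplx, dotProduct]

/-- The block degrees of the sphere equations. -/
def systemDeg (k : Free K ⊕ FreeEdge G K) : Free K → ℕ :=
  k.elim (fun u => vertexDeg u.1 + vertexDeg u.1) fun e => edgeDeg e.1

omit [DecidableEq V] in
theorem FreeEdge.not_isDiag (e : FreeEdge G K) : ¬ e.1.IsDiag :=
  G.not_isDiag_of_mem_edgeSet e.2.1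

theorem blockLE_euclSystem (θ : Param G K d → ℝ) (k : Free K ⊕ FreeEdge G K) :
    BlockLE (systemDeg k) (euclSystem θ k) := by
  have hX : ∀ v i, BlockLE (vertexDeg v) (euclCoord θ v i) := fun v i => by
    unfold euclCoord
    split_ifs
    exacts [blockLE_C _ _, blockLE_var _ _]
  have hS : ∀ v, BlockLE (vertexDeg v) (euclSq θ v) := fun v => by
    unfold euclSq
    split_ifs
    exacts [blockLE_C _ _, blockLE_var _ _]
  rcases k with u | e
  · refine BlockLE.sub (BlockLE.sum fun i _ => ?_) ((hS u).mono le_self_add)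
    rw [pow_two]
    exact (hX u i).mul (hX u i)
  · exact blockLE_edgePoly hX hS _ e.not_isDiag

theorem homEval_euclSystem [Fintype V] (θ : Param G K d → ℝ) (k : Free K ⊕ FreeEdge G K)
    (z : Free K → ℂ) (x : Var K d → ℂ) :
    homEval (systemDeg k) (euclSystem θ k) z x = euclHom (euclCplx θ) z x k := by
  rcases k with u | e
  · refine homEval_eq (F := fun z => euclHom (euclCplx θ) z x (Sum.inl u))
      (blockLE_euclSystem θ _) ?_ (fun z hz => ?_) z
    · simp only [euclHom]
      fun_prop
    · have hp : ∏ w, z w ^ systemDeg (Sum.inl u : Free K ⊕ FreeEdge G K) w = z u ^ 2 := by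
        rw [Finset.prod_eq_single u]
        · simp [systemDeg, vertexDeg]
        · intro w _ hw
          have : w.1 ≠ u.1 := fun h => hw (Subtype.ext h)
          simp [systemDeg, vertexDeg, this]
        · simp
      have hzu := hz u
      rw [hp, eval_euclSystem]
      simp only [euclHom, mul_pow, ← Finset.mul_sum]
      field_simp
  · refine homEval_edge e.not_isDiag (blockLE_euclSystem θ (Sum.inr e)) (fun z hz => ?_) z
    rw [eval_euclSystem]
    simp only [euclHom]
    congr 1
    · funext v
      unfold glue; split_ifs <;> rfl
    · funext v i
      unfold euclX glue
      split_ifs <;> simp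
    · funext v
      unfold euclS glue
      split_ifs <;> simp

/-- The homogenized sphere equations do not vanish identically at infinity. -/
theorem exists_euclHom_ne_zero (hd : 0 < d) (ϑ : Param G K d → ℂ) (k : Free K ⊕ FreeEdge G K) :
    ∃ x, euclHom ϑ (fun _ => 0) x k ≠ 0 := by
  have hd' : (d : ℂ) ≠ 0 := Nat.cast_ne_zero.2 hd.ne'
  rcases k with u | ⟨e, he, hK⟩
  · exact ⟨fun _ => 1, by simpa [euclHom] using hd'⟩
  · induction e with | _ u v
    simp only [Sym2.mem_iff, forall_eq_or_imp, forall_eq] at hK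
    by_cases hu : u ∈ K
    · have hv : v ∉ K := fun hv => hK ⟨hu, hv⟩
      -- With one fixed endpoint the term `s_v * 1` survives at infinity.
      refine ⟨fun a => if a.2 = Fin.last d then 1 else 0, ?_⟩
      simp [euclHom, euclX, euclS, glue_of_mem _ _ hu, glue_of_notMem _ _ hv, dotProduct,
        Fin.castSucc_ne_last]
    · by_cases hv : v ∈ K
      · refine ⟨fun a => if a.2 = Fin.last d then 1 else 0, ?_⟩
        simp [euclHom, euclX, euclS, glue_of_mem _ _ hv, glue_of_notMem _ _ hu, dotProduct,
          Fin.castSucc_ne_last]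
      -- With two free endpoints only `-2⟨x_u, x_v⟩` survives, and here it equals `-2d`.
      · refine ⟨fun _ => 1, ?_⟩
        simpa [euclHom, euclX, euclS, glue_of_notMem _ _ hv, glue_of_notMem _ _ hu, dotProduct]
          using hd'

end Euclid

/-! ### Genericity and the equivalence in the Euclidean case -/

section Euclid

variable {V : Type*} [DecidableEq V] {G : SimpleGraph V} {K : Finset V} {d : ℕ}

/-- Solutions at infinity of generic Euclidean systems can be moved off the coordinate
hyperplanes. -/
theorem eucl_generic_nonzero [Finite V] (z : Free K → ℂ) :
    ∃ Φ : MvPolynomial (Param G K d) ℂ, Φ ≠ 0 ∧ ∀ ϑ : Param G K d → ℂ, eval ϑ Φ ≠ 0 →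
      ∀ x, (∀ k, euclHom ϑ z x k = 0) → (∀ u, ∃ i : Fin d, x (u, i.castSucc) ≠ 0) →
        ∃ y : Var K d → ℂ, (∀ k, euclHom ϑ z y k = 0) ∧ ∀ a, y a ≠ 0 := by
  have := Fintype.ofFinite V
  have hev : ∀ (ϑ : Param G K d → ℂ) x k, eval (Sum.elim ϑ x)
      (euclHom (fun a => X (Sum.inl a)) (fun u => C (z u)) (fun a => X (Sum.inr a)) k) =
        euclHom ϑ z x k := fun ϑ x k => by
    rw [map_euclHom (eval (Sum.elim ϑ x))]
    simp
  obtain ⟨Φ, h0, hΦ⟩ := solvable_dichotomy (σ := Param G K d) (τ := Var K d)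
    (euclHom (fun a => X (Sum.inl a)) (fun u => C (z u)) (fun a => X (Sum.inr a)))
    (∏ a, X (Sum.inr a))
  simp only [hev, map_prod, eval_X, Sum.elim_inr, Finset.prod_ne_zero_iff, Finset.mem_univ,
    true_imp_iff] at hΦ
  refine ⟨Φ, h0, fun ϑ hϑ => ?_⟩
  -- In the second case `Φ` vanishes wherever a torus solution exists, and it remains to show that
  -- `Φ ϑ ≠ 0` rules out every solution with nonzero blocks.
  rcases hΦ with hΦ | hΦ
  · exact fun _ _ _ => hΦ ϑ hϑ
  -- a generic reflection
  have hrefl : ∀ (ϑ : Param G K d → ℂ) (x : Var K d → ℂ), (∀ k, euclHom ϑ z x k = 0) →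
      (∀ u, (fun i : Fin d => x (u, i.castSucc)) ≠ 0) → (∀ u, x (u, Fin.last d) ≠ 0) →
      ∀ a₀ : Fin d → ℂ, a₀ ⬝ᵥ a₀ ≠ 0 → eval (euclReflParam a₀ ϑ) Φ = 0 := by
    intro ϑ x hx hxne hxs a₀ ha₀
    by_contra hne
    -- The factor `⟨a, a⟩` keeps `a` non-isotropic, since the reflection multiplies `s_u` by `⟨a, a⟩
    -- ^ 2`.
    have hN : ∀ a : Fin d → ℂ, eval a (bind₁ (euclReflParam X fun b => C (ϑ b)) Φ *
        (∑ i, X i * X i)) = eval (euclReflParam a ϑ) Φ * (a ⬝ᵥ a) := fun a => by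
      rw [map_mul, eval_bind₁_eq]
      congr 1
      · congr 2
        funext b
        rcases b with ⟨v, i⟩ | e
        · simp [euclReflParam, map_refl]
        · simp [euclReflParam, dotProduct]
      · simp [dotProduct]
    obtain ⟨a, ha, haN⟩ := exists_refl_generic _ hxne
      (bind₁ (euclReflParam X fun b => C (ϑ b)) Φ * ∑ i, X i * X i) (a₀ := a₀)
      (by rw [hN]; exact mul_ne_zero hne ha₀)
    rw [hN] at haN
    refine left_ne_zero_of_mul haN (hΦ _ (euclReflVar a x) (fun k => ?_) ?_)
    · rw [euclHom_refl, hx, mul_zero]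
    · rintro ⟨u, j⟩
      induction j using Fin.lastCases with
      | last =>
        rw [euclReflVar_last]
        exact mul_ne_zero (pow_ne_zero _ (right_ne_zero_of_mul haN)) (hxs u)
      | cast i =>
        rw [euclReflVar_castSucc]
        exact ha u i
  have hrefl' : ∀ (ϑ : Param G K d → ℂ) (x : Var K d → ℂ), (∀ k, euclHom ϑ z x k = 0) →
      (∀ u, (fun i : Fin d => x (u, i.castSucc)) ≠ 0) → (∀ u, x (u, Fin.last d) ≠ 0) →
      0 < d → eval ϑ Φ = 0 := by
    intro ϑ x hx hxne hxs hd
    -- Reflection along a unit vector is an involution, so `ϑ` is itself a reflected parameter and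
    -- `hrefl` applies to its mirror image.
    have ha : (Pi.single ⟨0, hd⟩ 1 : Fin d → ℂ) ⬝ᵥ Pi.single ⟨0, hd⟩ 1 = 1 := by simp
    set a : Fin d → ℂ := Pi.single ⟨0, hd⟩ 1
    have hinv : ∀ y : Fin d → ℂ, refl a (refl a y) = y := fun y => by
      rw [refl_refl, ha, one_pow, one_smul]
    have h := hrefl (euclReflParam a ϑ) (euclReflVar a x)
      (fun k => by rw [euclHom_refl, hx, mul_zero])
      (fun u h => hxne u (by
        simp only [euclReflVar_castSucc] at h
        rw [← hinv (fun i => x (u, i.castSucc)), show refl a (fun i => x (u, i.castSucc)) = 0 from h]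
        funext j
        simp [refl]))
      (fun u => by simpa [ha] using hxs u) a (by rw [ha]; exact one_ne_zero)
    have he : euclReflParam a (euclReflParam a ϑ) = ϑ := by
      funext b
      rcases b with ⟨v, i⟩ | e
      · exact congrFun (hinv fun j => ϑ (Sum.inl (v, j))) i
      · simp [euclReflParam, ha]
    rwa [he] at h
  intro x hx hxne
  refine absurd ?_ hϑ
  by_contra hne
  rcases isEmpty_or_nonempty (Free K) with hemp | ⟨⟨u₀⟩⟩
  · exact hne (hΦ ϑ x hx fun a => isEmptyElim a.1)
  have hd : 0 < d := (hxne u₀).choose.pos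
  -- a generic translation
  have hev : ∀ τ : Fin d → ℂ, (fun b => eval τ (euclTransParam X (fun b => C (ϑ b)) b)) =
      euclTransParam τ ϑ := fun τ => by
    funext b
    rcases b with ⟨v, i⟩ | e <;> simp [euclTransParam]
  -- One `τ` keeps `Φ` nonzero, keeps a chosen coordinate of each block nonzero, and makes every
  -- `s_u` nonzero.
  obtain ⟨τ, hτ⟩ := exists_common_eval_ne_zero (σ := Fin d)
    (fun o : Option (Free K ⊕ Free K) => o.elim
      (bind₁ (euclTransParam X fun b => C (ϑ b)) Φ)
      (Sum.elim
        (fun u => euclTransVar X (fun w => C (z w)) (fun b => C (x b)) (u, (hxne u).choose.castSucc))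
        fun u => euclTransVar X (fun w => C (z w)) (fun b => C (x b)) (u, Fin.last d))) (by
    rintro (_ | u | u)
    · refine ⟨0, ?_⟩
      rw [Option.elim_none, eval_bind₁_eq, hev]
      have : euclTransParam 0 ϑ = ϑ := by
        funext b
        rcases b with ⟨v, i⟩ | e <;> simp [euclTransParam]
      rwa [this]
    · refine ⟨0, ?_⟩
      simpa [map_euclTransVar] using (hxne u).choose_spec
    · obtain ⟨i, hi⟩ := hxne u
      have h1 : ∀ c : ℂ, eval (Pi.single i c : Fin d → ℂ)
          (euclTransVar X (fun w => C (z w)) (fun b => C (x b)) (u, Fin.last d)) =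
          x (u, Fin.last d) + 2 * (x (u, i.castSucc) * c) + z u * (c * c) := fun c => by
        rw [map_euclTransVar (eval (Pi.single i c : Fin d → ℂ))]
        simp
      simp only [Option.elim_some, Sum.elim_inr]
      by_contra! h
      -- The difference of the values at `1` and `-1` is `4 * x_{u,i}`: the constant and quadratic
      -- terms cancel.
      have e0 := h (Pi.single i 0)
      have e1 := h (Pi.single i 1)
      have e2 := h (Pi.single i (-1))
      rw [h1] at e0 e1 e2
      exact hi (by linear_combination (e1 - e2) / 4))
  have hτ0 := hτ none
  have hev' : ∀ a, eval τ (euclTransVar X (fun w => C (z w)) (fun b => C (x b)) a)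
      = euclTransVar τ z x a := fun a => by
    rw [map_euclTransVar (eval τ)]
    simp
  rw [Option.elim_none, eval_bind₁_eq, hev] at hτ0
  refine hτ0 (hrefl' (euclTransParam τ ϑ) (euclTransVar τ z x) (fun k => by rw [euclHom_trans, hx])
    (fun u h => hτ (some (Sum.inl u)) ?_) (fun u => ?_) hd)
  · simp only [Option.elim_some, Sum.elim_inl, hev']
    exact congrFun h _
  · have := hτ (some (Sum.inr u))
    simpa only [Option.elim_some, Sum.elim_inr, hev'] using this

/-- Generic Euclidean systems have no solution on the coordinate hyperplanes. -/
theorem eucl_generic_affine [Finite V] (hd : 0 < d)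
    (hcard : Nat.card (Free K) * d ≤ Nat.card (FreeEdge G K)) :
    ∃ Φ : MvPolynomial (Param G K d) ℂ, Φ ≠ 0 ∧ ∀ ϑ : Param G K d → ℂ, eval ϑ Φ ≠ 0 →
      ∀ x, (∀ k, euclHom ϑ (fun _ => 1) x k = 0) → ∀ a, x a ≠ 0 := by
  have := Fintype.ofFinite V
  have := Fintype.ofFinite (FreeEdge G K)
  let υ := ({v : V // v ∈ K} × Fin d) ⊕ (Free K × Fin d)
  -- Zero lengths make the edge equation return the squared distance; `Q` parametrizes the
  -- configurations that satisfy the magnitude equations, and `f` sends a configuration to its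
  -- parameters.
  let P : Param G K d → MvPolynomial υ ℂ := Sum.elim (fun a => X (Sum.inl a)) 0
  let Q : Var K d → MvPolynomial υ ℂ := fun a => Fin.snoc (α := fun _ => MvPolynomial υ ℂ)
    (fun i => X (Sum.inr (a.1, i))) (∑ i, X (Sum.inr (a.1, i)) ^ 2) a.2
  let f : Param G K d → MvPolynomial υ ℂ := Sum.elim (fun a => X (Sum.inl a))
    fun e => euclHom P (fun _ => 1) Q (Sum.inr e)
  have hQ : ∀ a, Q a ≠ 0 := by
    rintro ⟨u, j⟩
    induction j using Fin.lastCases with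
    | last =>
      intro h
      have := congrArg (eval fun _ => (1 : ℂ)) h
      simp only [Q, Fin.snoc_last, map_sum, map_pow, eval_X, map_zero] at this
      simp only [one_pow, Finset.sum_const, Finset.card_univ, Fintype.card_fin, nsmul_eq_mul,
        mul_one, Nat.cast_eq_zero] at this
      exact hd.ne' this
    | cast i =>
      simp only [Q, Fin.snoc_castSucc]
      exact X_ne_zero _
  have hc : Fintype.card υ ≤ Fintype.card (Param G K d) := by
    rw [Nat.card_eq_fintype_card, Nat.card_eq_fintype_card] at hcard
    simp only [υ, Fintype.card_sum, Fintype.card_prod, Fintype.card_fin]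
    omega
  have key : ∀ a : Var K d, ∃ Φ : MvPolynomial (Param G K d) ℂ, Φ ≠ 0 ∧
      ∀ ϑ : Param G K d → ℂ, eval ϑ Φ ≠ 0 →
        ∀ x, (∀ k, euclHom ϑ (fun _ => 1) x k = 0) → x a ≠ 0 := by
    intro a
    -- `Q a` divides `Φ(f)`, so `Φ` vanishes at the parameters of every configuration with `x a =
    -- 0`.
    obtain ⟨Φ, h0, c, hc⟩ := exists_dvd_aeval hc f (Q a) (hQ a)
    refine ⟨Φ, h0, fun ϑ hϑ x hx hxa => hϑ ?_⟩
    let y : υ → ℂ := Sum.elim (fun b => ϑ (Sum.inl b)) fun b => x (b.1, b.2.castSucc)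
    have hQy : ∀ b, eval y (Q b) = x b := by
      rintro ⟨u, j⟩
      induction j using Fin.lastCases with
      | last =>
        have := hx (Sum.inl u)
        simp only [euclHom, mul_one, sub_eq_zero] at this
        simp [Q, y, this]
      | cast i => simp [Q, y]
    have hfy : (fun b => eval y (f b)) = ϑ := by
      funext b
      rcases b with b | e
      · simp [f, y]
      · have h1 := hx (Sum.inr e)
        simp only [f, Sum.elim_inr]
        rw [map_euclHom (eval y)]
        simp only [hQy, map_one]
        simp only [euclHom] at h1 ⊢
        have hX : euclX (fun a => eval y (P a)) x = euclX ϑ x := by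
          funext v i
          unfold euclX glue
          split_ifs <;> simp [P, y]
        have hS : euclS (fun a => eval y (P a)) x = euclS ϑ x := by
          funext v
          unfold euclS glue
          split_ifs <;> simp [P, y]
        have hZ : ∀ v, glue (K := K) (fun _ => (1 : ℂ)) (fun _ => 1) v = 1 := fun v => by
          unfold glue; split_ifs <;> rfl
        rw [hX, hS]
        obtain ⟨e, he⟩ := e
        induction e with | _ u v
        simp only [edgeForm_mk, hZ, P, Sum.elim_inr, Pi.zero_apply, map_zero] at h1 ⊢
        linear_combination h1
    rw [← hfy, ← eval_bind₁_eq, ← aeval_eq_bind₁, hc, map_mul, hQy, hxa, zero_mul]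
  choose Φ h0 hΦ using key
  refine ⟨∏ a, Φ a, Finset.prod_ne_zero_iff.2 fun a _ => h0 a, fun ϑ hϑ x hx a => ?_⟩
  rw [map_prod, Finset.prod_ne_zero_iff] at hϑ
  exact hΦ a ϑ (hϑ a (Finset.mem_univ a)) x hx

theorem euclSystem_inl (θ : Param G K d → ℝ) (u : Free K) : euclSystem θ (Sum.inl u) =
    ∑ i : Fin d, X (u, i.castSucc) ^ 2 - monomial (Finsupp.single (u, Fin.last d) 1) 1 := by
  simp only [euclSystem, euclCoord, euclSq, dif_neg u.2]
  rfl

/-- A toric face root has, in each block, a coordinate of minimal weight other than `s_u`. -/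
theorem eucl_exists_min [Fintype V] (θ : Param G K d → ℝ) {w : Var K d → ℝ} {D : Finset (Free K)}
    {y : Var K d → ℂ} (hw : ∀ a, w a = blockMin D a.1 ∨ w a = blockMin D a.1 + 1)
    (hD : ∀ u ∈ D, ∃ j, w (u, j) = -1) (hy : ∀ a, y a ≠ 0)
    (hr : ∀ k, eval y (initialForm w (euclSystem θ k)) = 0) (u : Free K) :
    ∃ j, j ≠ Fin.last d ∧ w (u, j) = blockMin D u := by
  by_contra! h
  have h1 : ∀ i : Fin d, w (u, i.castSucc) = blockMin D u + 1 := fun i =>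
    (hw (u, i.castSucc)).resolve_left (h _ (Fin.castSucc_ne_last i))
  have h2 := hr (Sum.inl u)
  rw [euclSystem_inl] at h2
  refine magnitude_initialForm_ne_zero (fun i : Fin d => (u, i.castSucc)) _ (fun i => ?_) hy h2
  rw [weight_single, h1]
  -- For `u ∈ D` the squares have weight `0` and `s_u` has weight `-1`; otherwise they have weight
  -- `2` and `s_u` at most `1`.
  by_cases hu : u ∈ D
  · obtain ⟨j, hj⟩ := hD u hu
    have hm : blockMin D u = -1 := if_pos hu
    induction j using Fin.lastCases with
    | last => rw [hj, hm]; norm_num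
    | cast i => rw [h1, hm] at hj; norm_num at hj
  · have hm : blockMin D u = 0 := if_neg hu
    rcases hw (u, Fin.last d) with h3 | h3 <;> simp only [h3, hm] <;> norm_num

/-- The Euclidean half of the theorem. -/
theorem eucl_generically [Fintype V] (hG : IsRigid G d) (hK : K.card = d) :
    HoldsGenerically (euclParams G K d) (fun θ => HasToricFaceRoot (euclSystem θ) ↔
      ∃ L : Free K → Fin (d + 1), (∀ u, L u ≠ Fin.last d) ∧ HasZeroDeltaRoot L (euclSystem θ)) := by
  classical
  have := Fintype.ofFinite (FreeEdge G K)
  -- For `d = 0` no coordinate other than `s_u` exists, and both sides are false.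
  rcases Nat.eq_zero_or_pos d with rfl | hd
  · refine ⟨1, ⟨fun _ => 1, fun _ => one_pos, by simp⟩, fun θ _ _ => ⟨fun h => ?_, ?_⟩⟩
    · obtain ⟨w, hw, y, hy, hr⟩ := h
      obtain ⟨D, hD, hb⟩ := hw.exists_blocks
      obtain ⟨a, -⟩ := Function.ne_iff.1 hw.1
      obtain ⟨j, hj, -⟩ := eucl_exists_min θ hb hD hy hr a.1
      exact (hj (Fin.ext (by simp))).elim
    · rintro ⟨L, hL, t, -, u, -⟩
      exact (hL u (Fin.ext (by simp))).elim
  obtain ⟨Φ₀, h₀, hΦ₀⟩ := eucl_generic_affine (G := G) hd (hG.le_card_freeEdge hK)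
  choose Φ₁ h₁ hΦ₁ using fun D : Finset (Free K) =>
    eucl_generic_nonzero (G := G) (d := d) fun u => if u ∈ D then 0 else 1
  let Ψ : MvPolynomial (Param G K d) ℂ := Φ₀ * ∏ D, Φ₁ D
  have hΨ : Ψ ≠ 0 := mul_ne_zero h₀ (Finset.prod_ne_zero_iff.2 fun D _ => h₁ D)
  -- A positive real point is needed because its edge parameters are squared lengths.
  obtain ⟨ϑ₀, hϑ₀, hne⟩ := exists_forall_eval_ne_zero (fun _ : Unit => Ψ) (fun _ => hΨ)
    (fun _ => (fun r : ℝ => (r : ℂ)) '' Set.Ioi 0)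
    (fun _ => (Set.Ioi_infinite 0).image Complex.ofReal_injective.injOn)
  choose r hr0 hr using hϑ₀
  let Ψ' : MvPolynomial (Param G K d) ℂ :=
    bind₁ (Sum.elim (fun a => X (Sum.inl a)) fun e => X (Sum.inr e) ^ 2) Ψ
  have hΨ' : ∀ θ : Param G K d → ℝ,
      eval (fun a => (θ a : ℂ)) Ψ' = eval (euclCplx θ) Ψ := fun θ => by
    rw [eval_bind₁_eq]
    congr 2
    funext a
    rcases a with a | e <;> simp [euclCplx]
  let θ₀ : Param G K d → ℝ := Sum.elim (fun a => r (Sum.inl a)) fun e => √(r (Sum.inr e))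
  have hθ₀ : euclCplx θ₀ = ϑ₀ := by
    funext a
    rcases a with a | e
    · exact hr _
    · rw [← hr]
      simp only [euclCplx, θ₀, Sum.elim_inr, ← Complex.ofReal_pow]
      rw [Real.sq_sqrt (le_of_lt (hr0 _))]
  obtain ⟨Φ, hΦ0, hΦ⟩ := exists_real_eval_ne_zero Ψ' θ₀ (by
    rw [hΨ', hθ₀]
    exact hne ())
  refine ⟨Φ, ⟨θ₀, fun e => Real.sqrt_pos.2 (hr0 _), hΦ0⟩, fun θ _ hθ => ?_⟩
  have hθ' := hΦ θ hθ
  rw [hΨ', map_mul] at hθ'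
  have hA := hΦ₀ _ (left_ne_zero_of_mul hθ')
  have hB : ∀ D, eval (euclCplx θ) (Φ₁ D) ≠ 0 := fun D => by
    have := right_ne_zero_of_mul hθ'
    rw [map_prod, Finset.prod_ne_zero_iff] at this
    exact this D (Finset.mem_univ D)
  constructor
  · refine exists_hasZeroDeltaRoot (fun w D y hw hD hy hr u => eucl_exists_min θ hw hD hy hr u)
      fun x hx => hA x fun k => ?_
    rw [← eval_euclSystem]
    exact hx k
  · rintro ⟨L, hL, h⟩
    -- One monomial must attain all block degrees at once for the face system along `∑ u ∈ D, δ_u`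
    -- to be the full part at infinity.
    have hat : ∀ k : Free K ⊕ FreeEdge G K, blockDegree (euclSystem θ k) = systemDeg k ∧
        ∃ β ∈ (euclSystem θ k).support, ∀ u, ∑ j, β (u, j) = systemDeg k u := fun k => by
      obtain ⟨x, hx⟩ := exists_euclHom_ne_zero hd (euclCplx θ) k
      rw [← homEval_euclSystem] at hx
      exact exists_attained (blockLE_euclSystem θ k) hx
    obtain ⟨D, hD, x, hxL, hx⟩ := h.exists_homEval
    simp only [(hat _).1, homEval_euclSystem] at hx
    obtain ⟨y, hy, hy0⟩ := hΦ₁ D _ (hB D) x hx fun u => by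
      obtain ⟨i, hi⟩ := Fin.exists_castSucc_eq.2 (hL u)
      exact ⟨i, hi ▸ hxL u⟩
    refine hasToricFaceRoot_of_homEval hD (blockLE_euclSystem θ) (fun k => (hat k).2) hy0
      fun k => ?_
    rw [homEval_euclSystem]
    exact hy k

end Euclid

/-! ### The sphere equations on the sphere -/

section Sphere

variable {V : Type*} [DecidableEq V] {G : SimpleGraph V} {K : Finset V} {d : ℕ}

section Defs

variable (G K d) in
/-- The parameters of the spherical systems with arbitrary magnitudes: the fixed points, the squared
magnitudes of the free vertices, and minus twice the inner products along the free edges. -/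
abbrev SphParam : Type _ := ({v : V // v ∈ K} × Fin (d + 1)) ⊕ (Free K ⊕ FreeEdge G K)

variable {R : Type*} [CommRing R]

/-- The coordinates of all vertices. -/
def sphX (ϑ : SphParam G K d → R) (x : Var K d → R) : V → Fin (d + 1) → R :=
  glue (fun v i => ϑ (Sum.inl (v, i))) fun u i => x (u, i)

/-- The homogenized spherical equations. -/
def sphHom (ϑ : SphParam G K d → R) (z : Free K → R) (x : Var K d → R) :
    Free K ⊕ FreeEdge G K → R
  | Sum.inl u => ∑ i, x (u, i) ^ 2 - ϑ (Sum.inr (Sum.inl u)) * z u ^ 2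
  | Sum.inr e =>
    edgeForm (glue (fun _ => 1) z) (sphX ϑ x) (fun _ => 0) (ϑ (Sum.inr (Sum.inr e))) e

theorem map_sphHom {R' : Type*} [CommRing R'] (φ : R →+* R') (ϑ : SphParam G K d → R)
    (z : Free K → R) (x : Var K d → R) (k : Free K ⊕ FreeEdge G K) : φ (sphHom ϑ z x k) =
      sphHom (fun a => φ (ϑ a)) (fun u => φ (z u)) (fun a => φ (x a)) k := by
  rcases k with u | e
  · simp only [sphHom, map_sub, map_sum, map_pow, map_mul]
  · simp only [sphHom, map_edgeForm, map_zero]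
    congr 1
    · funext v
      rw [map_glue φ]
      simp
    · funext v i
      unfold sphX glue
      split_ifs <;> rfl

/-- The action of a reflection on the parameters. -/
def sphReflParam (a : Fin (d + 1) → R) (ϑ : SphParam G K d → R) : SphParam G K d → R
  | Sum.inl (v, i) => refl a (fun j => ϑ (Sum.inl (v, j))) i
  | Sum.inr k => (a ⬝ᵥ a) ^ 2 * ϑ (Sum.inr k)

/-- The action of a reflection on the variables. -/
def sphReflVar (a : Fin (d + 1) → R) (x : Var K d → R) : Var K d → R :=
  fun b => refl a (fun i => x (b.1, i)) b.2

theorem sphHom_refl (a : Fin (d + 1) → R) (ϑ : SphParam G K d → R) (z : Free K → R)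
    (x : Var K d → R) (k : Free K ⊕ FreeEdge G K) :
    sphHom (sphReflParam a ϑ) z (sphReflVar a x) k = (a ⬝ᵥ a) ^ 2 * sphHom ϑ z x k := by
  rcases k with u | e
  · simp only [sphHom, sphReflVar, sphReflParam, sum_sq_eq_dotProduct, refl_dotProduct_refl]
    ring
  · have hX : sphX (sphReflParam a ϑ) (sphReflVar a x) = fun v => refl a (sphX ϑ x v) := by
      funext v
      rw [sphX, sphX, map_glue (refl a)]
      rfl
    simp only [sphHom]
    rw [hX, ← edgeForm_refl]
    simp only [mul_zero]
    rfl

/-- The action on the parameters of a scaling of the vertices. -/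
def sphScaleParam (c : V → R) (ϑ : SphParam G K d → R) : SphParam G K d → R
  | Sum.inl (v, i) => c v.1 * ϑ (Sum.inl (v, i))
  | Sum.inr (Sum.inl u) => c u.1 ^ 2 * ϑ (Sum.inr (Sum.inl u))
  | Sum.inr (Sum.inr e) => endProd c e.1 * ϑ (Sum.inr (Sum.inr e))

/-- The factors of the sphere equations under a scaling of the vertices. -/
def scaleFactor (c : V → R) : Free K ⊕ FreeEdge G K → R
  | Sum.inl u => c u.1 ^ 2
  | Sum.inr e => endProd c e.1

/-- The equations are homogeneous in each vertex once magnitudes and inner products are parameters,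
so unit spheres can be traded for spheres of any nonzero radii. -/
theorem sphHom_scale (c : V → R) (ϑ : SphParam G K d → R) (z : Free K → R) (x : Var K d → R)
    (k : Free K ⊕ FreeEdge G K) :
    sphHom (sphScaleParam c ϑ) z (fun a => c a.1.1 * x a) k = scaleFactor c k * sphHom ϑ z x k := by
  rcases k with u | ⟨e, he⟩
  · simp only [sphHom, sphScaleParam, scaleFactor, mul_pow, ← Finset.mul_sum]
    ring
  · have hX : sphX (sphScaleParam c ϑ) (fun a => c a.1.1 * x a) = fun v => c v • sphX ϑ x v := by
      funext v i
      simp only [sphX, glue, Pi.smul_apply, smul_eq_mul]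
      split_ifs <;> rfl
    simp only [sphHom, sphScaleParam, scaleFactor, hX]
    induction e with | _ u v
    simp only [edgeForm_mk, endProd_mk, smul_dotProduct, dotProduct_smul, smul_eq_mul]
    ring

end Defs

/-- The complex parameters of a spherical system. -/
def sphCplx (θ : Param G K (d + 1) → ℝ) : SphParam G K d → ℂ
  | Sum.inl a => (θ (Sum.inl a) : ℂ)
  | Sum.inr (Sum.inl _) => 1
  | Sum.inr (Sum.inr e) => (θ (Sum.inr e) : ℂ) ^ 2 - 2

theorem eval_sphSystem (θ : Param G K (d + 1) → ℝ) (x : Var K d → ℂ) (k : Free K ⊕ FreeEdge G K) :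
    eval x (sphSystem θ k) = sphHom (sphCplx θ) (fun _ => 1) x k := by
  have hX : ∀ v i, eval x (sphCoord θ v i) = sphX (sphCplx θ) x v i := fun v i => by
    unfold sphCoord sphX glue
    split_ifs
    · simp [sphCplx]
    · simp
  rcases k with u | e
  · simp only [sphSystem, sphHom, map_sub, map_sum, map_pow, hX, sphX, sphCplx, map_one,
      glue_of_notMem _ _ u.2, mul_one, one_pow]
  · obtain ⟨e, he⟩ := e
    simp only [sphSystem, sphHom]
    induction e with | _ u v
    have h1 : ∀ v, glue (K := K) (fun _ => (1 : ℂ)) (fun _ => 1) v = 1 := fun v => by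
      unfold glue; split_ifs <;> rfl
    simp [edgePoly, hX, h1, sphCplx, dotProduct]
    ring

theorem blockLE_sphSystem (θ : Param G K (d + 1) → ℝ) (k : Free K ⊕ FreeEdge G K) :
    BlockLE (systemDeg k) (sphSystem θ k) := by
  have hX : ∀ v i, BlockLE (vertexDeg v) (sphCoord θ v i) := fun v i => by
    unfold sphCoord
    split_ifs
    exacts [blockLE_C _ _, blockLE_var _ _]
  rcases k with u | e
  · refine BlockLE.sub (BlockLE.sum fun i _ => ?_) (C_1 (R := ℂ) ▸ blockLE_C _ _)
    rw [pow_two]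
    exact (hX u i).mul (hX u i)
  · exact blockLE_edgePoly hX (fun _ => C_1 (R := ℂ) ▸ blockLE_C _ _) _ e.not_isDiag

theorem homEval_sphSystem [Fintype V] (θ : Param G K (d + 1) → ℝ) (k : Free K ⊕ FreeEdge G K)
    (z : Free K → ℂ) (x : Var K d → ℂ) :
    homEval (systemDeg k) (sphSystem θ k) z x = sphHom (sphCplx θ) z x k := by
  rcases k with u | e
  · refine homEval_eq (F := fun z => sphHom (sphCplx θ) z x (Sum.inl u))
      (blockLE_sphSystem θ _) ?_ (fun z hz => ?_) z
    · simp only [sphHom]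
      fun_prop
    · have hp : ∏ w, z w ^ systemDeg (Sum.inl u : Free K ⊕ FreeEdge G K) w = z u ^ 2 := by
        rw [Finset.prod_eq_single u]
        · simp [systemDeg, vertexDeg]
        · intro w _ hw
          have : w.1 ≠ u.1 := fun h => hw (Subtype.ext h)
          simp [systemDeg, vertexDeg, this]
        · simp
      have hzu := hz u
      rw [hp, eval_sphSystem]
      simp only [sphHom, mul_pow, ← Finset.mul_sum]
      field_simp
  · refine homEval_edge e.not_isDiag (blockLE_sphSystem θ (Sum.inr e)) (fun z hz => ?_) z
    rw [eval_sphSystem]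
    simp only [sphHom]
    congr 1
    · funext v
      unfold glue; split_ifs <;> rfl
    · funext v i
      unfold sphX glue
      split_ifs <;> simp
    · funext v
      simp

/-- The homogenized sphere equations do not vanish identically at infinity. -/
theorem exists_sphHom_ne_zero (ϑ : SphParam G K d → ℂ)
    (hϑ : ∀ v, ∑ i, ϑ (Sum.inl (v, i)) ^ 2 ≠ 0) (k : Free K ⊕ FreeEdge G K) :
    ∃ x, sphHom ϑ (fun _ => 0) x k ≠ 0 := by
  have hd' : (d : ℂ) + 1 ≠ 0 := Nat.cast_add_one_ne_zero d
  rcases k with u | ⟨e, he, hK⟩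
  · exact ⟨fun _ => 1, by simpa [sphHom] using hd'⟩
  · induction e with | _ u v
    simp only [Sym2.mem_iff, forall_eq_or_imp, forall_eq] at hK
    by_cases hu : u ∈ K
    · have hv : v ∉ K := fun hv => hK ⟨hu, hv⟩
      -- Placing the free endpoint in the direction of the fixed one leaves `-2⟨p_u, p_u⟩`, nonzero
      -- by `hϑ`.
      refine ⟨fun a => ϑ (Sum.inl (⟨u, hu⟩, a.2)), ?_⟩
      simpa [sphHom, sphX, glue_of_mem _ _ hu, glue_of_notMem _ _ hv, ← sum_sq_eq_dotProduct]
        using hϑ ⟨u, hu⟩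
    · by_cases hv : v ∈ K
      · refine ⟨fun a => ϑ (Sum.inl (⟨v, hv⟩, a.2)), ?_⟩
        simpa [sphHom, sphX, glue_of_mem _ _ hv, glue_of_notMem _ _ hu, ← sum_sq_eq_dotProduct]
          using hϑ ⟨v, hv⟩
      · refine ⟨fun _ => 1, ?_⟩
        simpa [sphHom, sphX, glue_of_notMem _ _ hv, glue_of_notMem _ _ hu, dotProduct] using hd'

/-- Solutions at infinity of generic spherical systems can be moved off the coordinate
hyperplanes. -/
theorem sph_generic_nonzero [Finite V] (z : Free K → ℂ) :
    ∃ Φ : MvPolynomial (SphParam G K d) ℂ, Φ ≠ 0 ∧ ∀ ϑ : SphParam G K d → ℂ, eval ϑ Φ ≠ 0 →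
      ∀ x, (∀ k, sphHom ϑ z x k = 0) → (∀ u, ∃ i, x (u, i) ≠ 0) →
        ∃ y : Var K d → ℂ, (∀ k, sphHom ϑ z y k = 0) ∧ ∀ a, y a ≠ 0 := by
  have := Fintype.ofFinite V
  have hev : ∀ (ϑ : SphParam G K d → ℂ) x k, eval (Sum.elim ϑ x)
      (sphHom (fun a => X (Sum.inl a)) (fun u => C (z u)) (fun a => X (Sum.inr a)) k) =
        sphHom ϑ z x k := fun ϑ x k => by
    rw [map_sphHom (eval (Sum.elim ϑ x))]
    simp
  obtain ⟨Φ, h0, hΦ⟩ := solvable_dichotomy (σ := SphParam G K d) (τ := Var K d)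
    (sphHom (fun a => X (Sum.inl a)) (fun u => C (z u)) (fun a => X (Sum.inr a)))
    (∏ a, X (Sum.inr a))
  simp only [hev, map_prod, eval_X, Sum.elim_inr, Finset.prod_ne_zero_iff, Finset.mem_univ,
    true_imp_iff] at hΦ
  refine ⟨Φ, h0, fun ϑ hϑ => ?_⟩
  rcases hΦ with hΦ | hΦ
  · exact fun _ _ _ => hΦ ϑ hϑ
  -- a generic reflection
  have hrefl : ∀ (ϑ : SphParam G K d → ℂ) (x : Var K d → ℂ), (∀ k, sphHom ϑ z x k = 0) →
      (∀ u, (fun i => x (u, i)) ≠ 0) →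
      ∀ a₀ : Fin (d + 1) → ℂ, eval (sphReflParam a₀ ϑ) Φ = 0 := by
    intro ϑ x hx hxne a₀
    by_contra hne
    have hN : ∀ a : Fin (d + 1) → ℂ, eval a (bind₁ (sphReflParam X fun b => C (ϑ b)) Φ) =
        eval (sphReflParam a ϑ) Φ := fun a => by
      rw [eval_bind₁_eq]
      congr 2
      funext b
      rcases b with ⟨v, i⟩ | k
      · simp [sphReflParam, map_refl]
      · simp [sphReflParam, dotProduct]
    obtain ⟨a, ha, haN⟩ := exists_refl_generic _ hxne
      (bind₁ (sphReflParam X fun b => C (ϑ b)) Φ) (a₀ := a₀) (by rwa [hN])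
    rw [hN] at haN
    exact haN (hΦ _ (sphReflVar a x) (fun k => by rw [sphHom_refl, hx, mul_zero])
      fun b => ha b.1 b.2)
  intro x hx hxne
  refine absurd ?_ hϑ
  have hxne' : ∀ u, (fun i => x (u, i)) ≠ 0 := fun u h => by
    obtain ⟨i, hi⟩ := hxne u
    exact hi (congrFun h i)
  have ha : (Pi.single 0 1 : Fin (d + 1) → ℂ) ⬝ᵥ Pi.single 0 1 = 1 := by simp
  set a : Fin (d + 1) → ℂ := Pi.single 0 1
  have hinv : ∀ y : Fin (d + 1) → ℂ, refl a (refl a y) = y := fun y => by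
    rw [refl_refl, ha, one_pow, one_smul]
  have h := hrefl (sphReflParam a ϑ) (sphReflVar a x)
    (fun k => by rw [sphHom_refl, hx, mul_zero])
    (fun u h => hxne' u (by
      rw [← hinv (fun i => x (u, i)), show refl a (fun i => x (u, i)) = 0 from h]
      funext j
      simp [refl])) a
  have he : sphReflParam a (sphReflParam a ϑ) = ϑ := by
    funext b
    rcases b with ⟨v, i⟩ | k
    · exact congrFun (hinv fun j => ϑ (Sum.inl (v, j))) i
    · simp [sphReflParam, ha]
  rwa [he] at h

/-- Generic spherical systems have no solution on the coordinate hyperplanes. -/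
theorem sph_generic_affine [Finite V]
    (hcard : Nat.card (Free K) * d ≤ Nat.card (FreeEdge G K)) :
    ∃ Φ : MvPolynomial (SphParam G K d) ℂ, Φ ≠ 0 ∧ ∀ ϑ : SphParam G K d → ℂ, eval ϑ Φ ≠ 0 →
      ∀ x, (∀ k, sphHom ϑ (fun _ => 1) x k = 0) → ∀ a, x a ≠ 0 := by
  have := Fintype.ofFinite V
  have := Fintype.ofFinite (FreeEdge G K)
  let υ := ({v : V // v ∈ K} × Fin (d + 1)) ⊕ Var K d
  let P : SphParam G K d → MvPolynomial υ ℂ := Sum.elim (fun a => X (Sum.inl a)) 0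
  let Q : Var K d → MvPolynomial υ ℂ := fun a => X (Sum.inr a)
  -- Zero magnitudes and inner products in `P` make the equations return their actual values. The
  -- magnitudes count as parameters, matching the `d + 1` coordinates of a free vertex.
  let f : SphParam G K d → MvPolynomial υ ℂ := Sum.elim (fun a => X (Sum.inl a))
    fun k => sphHom P (fun _ => 1) Q k
  have hc : Fintype.card υ ≤ Fintype.card (SphParam G K d) := by
    rw [Nat.card_eq_fintype_card, Nat.card_eq_fintype_card] at hcard
    simp only [υ, Fintype.card_sum, Fintype.card_prod, Fintype.card_fin, mul_add, mul_one]
    omega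
  have key : ∀ a : Var K d, ∃ Φ : MvPolynomial (SphParam G K d) ℂ, Φ ≠ 0 ∧
      ∀ ϑ : SphParam G K d → ℂ, eval ϑ Φ ≠ 0 →
        ∀ x, (∀ k, sphHom ϑ (fun _ => 1) x k = 0) → x a ≠ 0 := by
    intro a
    obtain ⟨Φ, h0, c, hc⟩ := exists_dvd_aeval hc f (Q a) (X_ne_zero _)
    refine ⟨Φ, h0, fun ϑ hϑ x hx hxa => hϑ ?_⟩
    let y : υ → ℂ := Sum.elim (fun b => ϑ (Sum.inl b)) x
    have hQy : ∀ b, eval y (Q b) = x b := fun b => by simp [Q, y]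
    have hfy : (fun b => eval y (f b)) = ϑ := by
      funext b
      rcases b with b | k
      · simp [f, y]
      · have h1 := hx k
        simp only [f, Sum.elim_inr]
        rw [map_sphHom (eval y)]
        simp only [hQy, map_one]
        have hX : sphX (fun a => eval y (P a)) x = sphX ϑ x := by
          funext v i
          unfold sphX glue
          split_ifs <;> simp [P, y]
        have hZ : ∀ v, glue (K := K) (fun _ => (1 : ℂ)) (fun _ => 1) v = 1 := fun v => by
          unfold glue; split_ifs <;> rfl
        rcases k with u | ⟨e, he⟩
        · simp only [sphHom, P, Sum.elim_inr, Pi.zero_apply, map_zero] at h1 ⊢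
          linear_combination h1
        · simp only [sphHom] at h1 ⊢
          rw [hX]
          induction e with | _ u v
          simp only [edgeForm_mk, hZ, P, Sum.elim_inr, Pi.zero_apply, map_zero] at h1 ⊢
          linear_combination h1
    rw [← hfy, ← eval_bind₁_eq, ← aeval_eq_bind₁, hc, map_mul, hQy, hxa, zero_mul]
  choose Φ h0 hΦ using key
  refine ⟨∏ a, Φ a, Finset.prod_ne_zero_iff.2 fun a _ => h0 a, fun ϑ hϑ x hx a => ?_⟩
  rw [map_prod, Finset.prod_ne_zero_iff] at hϑ
  exact hΦ a ϑ (hϑ a (Finset.mem_univ a)) x hx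

theorem sphSystem_inl (θ : Param G K (d + 1) → ℝ) (u : Free K) : sphSystem θ (Sum.inl u) =
    ∑ i, X (u, i) ^ 2 - monomial 0 1 := by
  simp only [sphSystem, sphCoord, dif_neg u.2]
  rfl

/-- A toric face root has a coordinate of minimal weight in each block. -/
theorem sph_exists_min [Fintype V] (θ : Param G K (d + 1) → ℝ) {w : Var K d → ℝ}
    {D : Finset (Free K)} {y : Var K d → ℂ}
    (hw : ∀ a, w a = blockMin D a.1 ∨ w a = blockMin D a.1 + 1)
    (hD : ∀ u ∈ D, ∃ j, w (u, j) = -1) (hy : ∀ a, y a ≠ 0)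
    (hr : ∀ k, eval y (initialForm w (sphSystem θ k)) = 0) (u : Free K) :
    ∃ j, w (u, j) = blockMin D u := by
  by_cases hu : u ∈ D
  · obtain ⟨j, hj⟩ := hD u hu
    exact ⟨j, hj.trans (if_pos hu).symm⟩
  by_contra! h
  -- All coordinates of the block would have weight `1`, leaving the constant `-1` as the initial
  -- form.
  have hm : blockMin D u = 0 := if_neg hu
  have h2 := hr (Sum.inl u)
  rw [sphSystem_inl] at h2
  refine magnitude_initialForm_ne_zero (fun i => (u, i)) _ (fun i => ?_) hy h2
  rw [(hw (u, i)).resolve_left (h i)]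
  simp [weight, hm]

omit [DecidableEq V] in
theorem endProd_ofReal (c : V → ℝ) (e : Sym2 V) :
    endProd (fun v => (c v : ℂ)) e = (endProd c e : ℝ) := by
  induction e with | _ u v
  simp

/-- The spherical half of the theorem. -/
theorem sph_generically [Fintype V] (hG : IsRigid G d) (hK : K.card = d) :
    HoldsGenerically (sphParams G K d) (fun θ => HasToricFaceRoot (sphSystem θ) ↔
      ∃ L : Free K → Fin (d + 1), HasZeroDeltaRoot L (sphSystem θ)) := by
  classical
  have := Fintype.ofFinite (FreeEdge G K)
  obtain ⟨Φ₀, h₀, hΦ₀⟩ := sph_generic_affine (hG.le_card_freeEdge hK)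
  choose Φ₁ h₁ hΦ₁ using fun D : Finset (Free K) =>
    sph_generic_nonzero (G := G) (d := d) fun u => if u ∈ D then 0 else 1
  let Ψ : MvPolynomial (SphParam G K d) ℂ := Φ₀ * ∏ D, Φ₁ D
  have hΨ : Ψ ≠ 0 := mul_ne_zero h₀ (Finset.prod_ne_zero_iff.2 fun D _ => h₁ D)
  obtain ⟨ϑ₀, hϑ₀, hne⟩ := exists_forall_eval_ne_zero (fun _ : Unit => Ψ) (fun _ => hΨ)
    (fun _ => (fun r : ℝ => (r : ℂ)) '' Set.Ioi 0)
    (fun _ => (Set.Ioi_infinite 0).image Complex.ofReal_injective.injOn)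
  choose r hr0 hr using hϑ₀
  -- the scaling that normalizes the magnitudes
  have hsum : ∀ v, 0 < ∑ i, r (Sum.inl (v, i)) ^ 2 := fun v =>
    Finset.sum_pos (fun i _ => pow_pos (hr0 _) 2) Finset.univ_nonempty
  let c : V → ℝ := glue (fun v => √(∑ i, r (Sum.inl (v, i)) ^ 2)) fun u => √(r (Sum.inr (Sum.inl u)))
  have hc : ∀ v, 0 < c v := fun v => by
    simp only [c, glue]
    split_ifs
    exacts [Real.sqrt_pos.2 (hsum _), Real.sqrt_pos.2 (hr0 _)]
  have hcp : ∀ e, 0 < endProd c e := fun e => by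
    induction e with | _ u v
    exact mul_pos (hc u) (hc v)
  -- The scaling `c` is fixed once by the chosen point, so the condition remains polynomial in `θ`.
  let Ψ' : MvPolynomial (Param G K (d + 1)) ℂ :=
    bind₁ (sphScaleParam (fun v => C (c v : ℂ)) (Sum.elim (fun a => X (Sum.inl a))
      (Sum.elim 1 fun e => X (Sum.inr e) ^ 2 - C 2))) Ψ
  have hΨ' : ∀ θ : Param G K (d + 1) → ℝ, eval (fun a => (θ a : ℂ)) Ψ' =
      eval (sphScaleParam (fun v => (c v : ℂ)) (sphCplx θ)) Ψ := fun θ => by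
    rw [eval_bind₁_eq]
    congr 2
    funext a
    rcases a with a | u | ⟨e, he⟩
    · simp [sphCplx, sphScaleParam]
    · simp [sphCplx, sphScaleParam]
    · induction e with | _ u v
      simp [sphCplx, sphScaleParam]
  -- The edge parameter on the unit sphere is `λ² - 2`; solving `c_u * c_v * (λ² - 2) = r` gives
  -- this length.
  let θ₀ : Param G K (d + 1) → ℝ := Sum.elim (fun a => r (Sum.inl a) / c a.1)
    fun e => √(2 + r (Sum.inr (Sum.inr e)) / endProd c e)
  have hpos : ∀ e : FreeEdge G K, 0 < 2 + r (Sum.inr (Sum.inr e)) / endProd c e.1 := fun e =>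
    add_pos two_pos (div_pos (hr0 _) (hcp _))
  have hθ₀ : sphScaleParam (fun v => (c v : ℂ)) (sphCplx θ₀) = ϑ₀ := by
    funext a
    have hc' : ∀ v, (c v : ℂ) ≠ 0 := fun v => Complex.ofReal_ne_zero.2 (hc v).ne'
    rw [← hr]
    rcases a with ⟨v, i⟩ | u | e
    · simp only [sphScaleParam, sphCplx, θ₀, Sum.elim_inl, Complex.ofReal_div]
      exact mul_div_cancel₀ _ (hc' v)
    · simp only [sphScaleParam, sphCplx, mul_one, ← Complex.ofReal_pow]
      congr 1
      simp only [c, glue_of_notMem _ _ u.2]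
      exact Real.sq_sqrt (hr0 _).le
    · simp only [sphScaleParam, sphCplx, θ₀, Sum.elim_inr, ← Complex.ofReal_pow, endProd_ofReal]
      rw [Real.sq_sqrt (hpos e).le]
      have := Complex.ofReal_ne_zero.2 (hcp e.1).ne'
      push_cast
      field_simp
      ring
  obtain ⟨Φ, hΦ0, hΦ⟩ := exists_real_eval_ne_zero Ψ' θ₀ (by
    rw [hΨ', hθ₀]
    exact hne ())
  refine ⟨Φ, ⟨θ₀, ⟨fun e => Real.sqrt_pos.2 (hpos e), fun v => ?_⟩, hΦ0⟩, fun θ hθS hθ => ?_⟩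
  · simp only [θ₀, Sum.elim_inl, div_pow, ← Finset.sum_div]
    simp only [c, glue_of_mem _ _ v.2]
    rw [Real.sq_sqrt (hsum v).le, div_self (hsum v).ne']
  have hθ' := hΦ θ hθ
  rw [hΨ', map_mul] at hθ'
  have hc' : ∀ v, (c v : ℂ) ≠ 0 := fun v => Complex.ofReal_ne_zero.2 (hc v).ne'
  have hA : ∀ x, (∀ k, sphHom (sphCplx θ) (fun _ => 1) x k = 0) → ∀ a, x a ≠ 0 := fun x hx a =>
    right_ne_zero_of_mul (hΦ₀ _ (left_ne_zero_of_mul hθ') (fun a => (c a.1.1 : ℂ) * x a)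
      (fun k => by rw [sphHom_scale (fun v => (c v : ℂ)), hx, mul_zero]) a)
  have hB : ∀ (D : Finset (Free K)) x,
      (∀ k, sphHom (sphCplx θ) (fun u => if u ∈ D then 0 else 1) x k = 0) →
      (∀ u, ∃ i, x (u, i) ≠ 0) → ∃ y : Var K d → ℂ,
        (∀ k, sphHom (sphCplx θ) (fun u => if u ∈ D then 0 else 1) y k = 0) ∧ ∀ a, y a ≠ 0 := by
    intro D x hx hxne
    have hD := right_ne_zero_of_mul hθ'
    rw [map_prod, Finset.prod_ne_zero_iff] at hD
    obtain ⟨y, hy, hy0⟩ := hΦ₁ D _ (hD D (Finset.mem_univ D)) (fun a => (c a.1.1 : ℂ) * x a)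
      (fun k => by rw [sphHom_scale (fun v => (c v : ℂ)), hx, mul_zero])
      (fun u => by
        obtain ⟨i, hi⟩ := hxne u
        exact ⟨i, mul_ne_zero (hc' _) hi⟩)
    -- The torus solution of the scaled system is scaled back; the factors relating the equations
    -- are nonzero.
    refine ⟨fun a => (c a.1.1 : ℂ)⁻¹ * y a, fun k => ?_,
      fun a => mul_ne_zero (inv_ne_zero (hc' _)) (hy0 a)⟩
    have hs := sphHom_scale (fun v => (c v : ℂ)) (sphCplx θ) (fun u => if u ∈ D then 0 else 1)
      (fun a => (c a.1.1 : ℂ)⁻¹ * y a) k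
    simp only [mul_inv_cancel_left₀ (hc' _), hy k] at hs
    refine (mul_eq_zero.1 hs.symm).resolve_left ?_
    rcases k with u | e
    · exact pow_ne_zero 2 (hc' _)
    · simp only [scaleFactor, endProd_ofReal]
      exact Complex.ofReal_ne_zero.2 (hcp _).ne'
  constructor
  · intro h
    obtain ⟨L, -, hL⟩ := exists_hasZeroDeltaRoot (P := fun _ => True)
      (fun w D y hw hD hy hr u => by simpa using sph_exists_min θ hw hD hy hr u)
      (fun x hx => hA x fun k => by rw [← eval_sphSystem]; exact hx k) h
    exact ⟨L, hL⟩
  · rintro ⟨L, h⟩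
    have hat : ∀ k : Free K ⊕ FreeEdge G K, blockDegree (sphSystem θ k) = systemDeg k ∧
        ∃ β ∈ (sphSystem θ k).support, ∀ u, ∑ j, β (u, j) = systemDeg k u := fun k => by
      obtain ⟨x, hx⟩ := exists_sphHom_ne_zero (sphCplx θ) (fun v => by
        simp only [sphCplx]
        have := hθS.2 v
        rw [← Complex.ofReal_inj] at this
        push_cast at this
        rw [this]
        exact one_ne_zero) k
      rw [← homEval_sphSystem] at hx
      exact exists_attained (blockLE_sphSystem θ k) hx
    obtain ⟨D, hD, x, hxL, hx⟩ := h.exists_homEval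
    simp only [(hat _).1, homEval_sphSystem] at hx
    obtain ⟨y, hy, hy0⟩ := hB D x hx fun u => ⟨_, hxL u⟩
    refine hasToricFaceRoot_of_homEval hD (blockLE_sphSystem θ) (fun k => (hat k).2) hy0
      fun k => ?_
    rw [homEval_sphSystem]
    exact hy k

end Sphere

end SphereEq

end

theorem mainTheorem6 {V : Type*} [Fintype V] [DecidableEq V] (d : ℕ) (G : SimpleGraph V)
    (hG : SphereEq.IsMinimallyRigid G d) (K : Finset V) (hK : G.IsNClique d K) :
    SphereEq.HoldsGenerically (SphereEq.euclParams G K d) (fun θ =>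
      SphereEq.HasToricFaceRoot (SphereEq.euclSystem θ) ↔
        ∃ L : SphereEq.Free K → Fin (d + 1), (∀ u, L u ≠ Fin.last d) ∧
          SphereEq.HasZeroDeltaRoot L (SphereEq.euclSystem θ)) ∧
    SphereEq.HoldsGenerically (SphereEq.sphParams G K d) (fun θ =>
      SphereEq.HasToricFaceRoot (SphereEq.sphSystem θ) ↔
        ∃ L : SphereEq.Free K → Fin (d + 1),
          SphereEq.HasZeroDeltaRoot L (SphereEq.sphSystem θ)) := by
  exact ⟨SphereEq.eucl_generically hG.1 hK.card_eq, SphereEq.sph_generically hG.1 hK.card_eq⟩
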